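/- Consider $n$ transmitter–receiver pairs (links). For each $n$, let the channel coefficients $g_{ji}$ from transmitter $j$ to receiver $i$ ($1\le i,j\le n$) be independent exponential random variables with mean $1$. Fix the transmit SNR $\rho>0$ and $\gamma_0>0$. For a set $\mathcal A\subseteq\{1,\dots,n\}$ of active links and $i\in\mathcal A$ let $$I_i=\sum_{j\in\mathcal A,\ j\ne i} g_{ji},\qquad r_i=\log\Bigl(1+\frac{g_{ii}}{1/\rho+I_i}\Bigr)$$ be the interference and the rate of link $i$. The double-threshold-based link activation strategy (DTBLAS) with thresholds $\Delta,\delta$ first takes $\mathcal A_1=\{i: g_{ii}>\Delta\}$ and then activates a largest set $\mathcal A\subseteq\mathcal A_1$ such that $g_{ij}\le\delta$ and $g_{ji}\le\delta$ for all distinct $i,j\in\mathcal A$; equivalently, a maximum clique of the graph $G$ with vertex set $\mathcal A_1$ in which distinct $i,j$ are adjacent iff $g_{ij}\le\delta$ and $g_{ji}\le\delta$. If there are several largest sets, the choice among them is arbitrary (possibly randomized or using the direct coefficients $g_{ii}$), but uses the cross coefficients $g_{ji}$, $j\neq i$, only through $G$: conditionally on $G$, the set $\mathcal A$ is independent of the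 cross coefficients. Let $\beta=\beta(n)>0$ satisfy $\beta=O(1)$ and $|\log\beta|=o(\log\log n)$ as $n\to\infty$ (for instance, a positive constant). Use DTBLAS with $$\Delta=\gamma_0\Bigl(\frac1\rho+\beta\Bigr),\qquad \delta=\frac{2\beta\log\log n}{\log n}\,(1+o(1)).$$ Then asymptotically almost surely $|I_i-\beta|\to0$ for all active links, and the network operates in the noise-limited regime, i.e. there is a deterministic sequence $\varepsilon_n\to0$ such that, with probability tending to $1$ as $n\to\infty$, for all $i\in\mathcal A$, $$|I_i-\beta|\le\varepsilon_n\qquad\text{and}\qquad\Bigl|\,r_i-\log\Bigl(1+\frac{g_{ii}}{1/\rho+\beta}\Bigr)\Bigr|\le\varepsilon_n .$$ -/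

import Mathlib

open MeasureTheory ProbabilityTheory Filter Topology Asymptotics

noncomputable section

namespace RayleighNetwork

/-- The i.i.d. Rayleigh fading model for `n` links: `g ω j i` is the channel coefficient from
transmitter `j` to receiver `i`; all `n ^ 2` coefficients are independent, and each is exponential
with mean `1`. -/
structure IsRayleighFading {Ω : Type*} [MeasurableSpace Ω] {n : ℕ}
    (μ : Measure Ω) (g : Ω → Fin n → Fin n → ℝ) : Prop where
  measurable : ∀ j i, Measurable (fun ω => g ω j i)
  law : ∀ j i, μ.map (fun ω => g ω j i) = expMeasure 1
  indep : iIndepFun (fun (p : Fin n × Fin n) ω => g ω p.1 p.2) μ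

variable {n : ℕ}

/-- Interference `I_i` observed by link `i` when `A` is the set of active links. -/
def interference (g : Fin n → Fin n → ℝ) (A : Finset (Fin n)) (i : Fin n) : ℝ :=
  ∑ j ∈ A.erase i, g j i

/-- Signal-to-interference-plus-noise ratio of link `i`, for the transmit SNR `ρ`. -/
def sinr (ρ : ℝ) (g : Fin n → Fin n → ℝ) (A : Finset (Fin n)) (i : Fin n) : ℝ :=
  g i i / (1 / ρ + interference g A i)

/-- Maximum supportable rate of link `i`, in nats per channel use. -/
def rate (ρ : ℝ) (g : Fin n → Fin n → ℝ) (A : Finset (Fin n)) (i : Fin n) : ℝ :=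
  Real.log (1 + sinr ρ g A i)

/-- The rate that link `i` has in the noise-limited regime with interference level `β`. -/
def noiseLimitedRate (ρ β : ℝ) (g : Fin n → Fin n → ℝ) (i : Fin n) : ℝ :=
  Real.log (1 + g i i / (1 / ρ + β))

open Classical in
/-- Phase one: all the links whose direct coefficient exceeds the threshold `Δ`. -/
def phaseOne (Δ : ℝ) (g : Fin n → Fin n → ℝ) : Finset (Fin n) :=
  Finset.univ.filter fun i => Δ < g i i

/-- The candidates of phase two: sets of links that survive phase one and whose mutual cross
coefficients are all at most `δ`. -/
def IsAdmissible (Δ δ : ℝ) (g : Fin n → Fin n → ℝ) (A : Finset (Fin n)) : Prop :=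
  A ⊆ phaseOne Δ g ∧ ∀ i ∈ A, ∀ j ∈ A, i ≠ j → g i j ≤ δ ∧ g j i ≤ δ

/-- A possible outcome of DTBLAS: a candidate of the largest possible size. -/
def IsDTBLASOutcome (Δ δ : ℝ) (g : Fin n → Fin n → ℝ) (A : Finset (Fin n)) : Prop :=
  IsAdmissible Δ δ g A ∧ ∀ B : Finset (Fin n), IsAdmissible Δ δ g B → B.card ≤ A.card

/-- The graph on the vertex set `phaseOne Δ g` in which two distinct links are adjacent when both
cross coefficients between them are at most `δ`. DTBLAS outcomes are its maximum cliques. -/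
def compatGraph (Δ δ : ℝ) (g : Fin n → Fin n → ℝ) : (⊤ : SimpleGraph (Fin n)).Subgraph where
  verts := phaseOne Δ g
  Adj i j := i ∈ phaseOne Δ g ∧ j ∈ phaseOne Δ g ∧ i ≠ j ∧ g i j ≤ δ ∧ g j i ≤ δ
  adj_sub h := h.2.2.1
  edge_vert h := h.1
  symm := ⟨fun _ _ h => ⟨h.2.1, h.1, h.2.2.1.symm, h.2.2.2.2, h.2.2.2.1⟩⟩

/-- The family of all the cross coefficients. -/
def crossGains (g : Fin n → Fin n → ℝ) : {p : Fin n × Fin n // p.1 ≠ p.2} → ℝ :=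
  fun p => g p.1.1 p.1.2

/-- The random set `A` is the set of active links that DTBLAS with thresholds `Δ` and `δ` selects.
There may be several largest candidates; the choice among them is arbitrary (deterministic,
randomized, or based on the direct coefficients), as long as the cross coefficients enter it only
through the graph in which a maximum clique is to be chosen: given the graph, the choice is
independent of the cross coefficients. -/
structure IsDTBLAS {Ω : Type*} [MeasurableSpace Ω] (μ : Measure Ω)
    (g : Ω → Fin n → Fin n → ℝ) (Δ δ : ℝ) (A : Ω → Finset (Fin n)) : Prop where
  measurable : Measurable[_, ⊤] A
  outcome : ∀ ω, IsDTBLASOutcome Δ δ (g ω) (A ω)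
  graph_based : ∀ H : (⊤ : SimpleGraph (Fin n)).Subgraph,
    Indep (MeasurableSpace.comap A ⊤)
      (MeasurableSpace.comap (fun ω => crossGains (g ω)) inferInstance)
      (ProbabilityTheory.cond μ {ω | compatGraph Δ δ (g ω) = H})

end RayleighNetwork

end

/-! Write `L = log n`, `l = log log n`, `s = 1 - exp (-δ)`. Two facts combine: the number of active
links is about `L / l`, and each incoming cross coefficient inside the active clique behaves like a
uniform variable on `[0, δ]`, of mean `δ / 2`. Since `δ ~ 2 * β * l / L`, the product is about `β`.

Clique size: a pair is compatible with probability `s ^ 2`, and `log s ~ -l`. A first moment bound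
(`measure_le_card_le`) excludes more than `(1 + ε) * L / l` links; a second moment bound
(`measureReal_card_lt_le`) excludes fewer than `(1 - ε) * L / l`.

Interference: once the graph is known and `i` is adjacent to all of `R`, the coefficients from `R`
to `i` are independent exponentials conditioned only on being at most `δ`, so a Chernoff bound
applies (`measure_compatGraph_eq_and_lt_abs_le`). The choice of clique is conditionally independent
of these values, so the bound survives for the selected set with no union over cliques; only the
active links cost a union bound.

The rate is Lipschitz in the interference, and a diagonal argument turns fixed tolerances into one
sequence. -/

/-! ### Exponential law: tails and truncated exponential moments -/

lemma expMeasure_Iic {r x : ℝ} (hr : 0 < r) (hx : 0 ≤ x) :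
    expMeasure r (Set.Iic x) = ENNReal.ofReal (1 - Real.exp (-(r * x))) := by
  have := isProbabilityMeasure_expMeasure hr
  rw [← ofReal_cdf, cdf_expMeasure_eq hr, if_pos hx]

lemma expMeasure_Ioi {r x : ℝ} (hr : 0 < r) (hx : 0 ≤ x) :
    expMeasure r (Set.Ioi x) = ENNReal.ofReal (Real.exp (-(r * x))) := by
  have := isProbabilityMeasure_expMeasure hr
  rw [← Set.compl_Iic, prob_compl_eq_one_sub measurableSet_Iic, expMeasure_Iic hr hx,
    ← ENNReal.ofReal_one, ← ENNReal.ofReal_sub]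
  · congr 1; ring
  · rw [sub_nonneg, Real.exp_le_one_iff]
    nlinarith

/-- The density is at most one. Passing to Lebesgue measure makes the truncated law symmetric about
`d / 2`, at the price of a factor at most `exp d` per variable. -/
lemma expMeasure_one_le_restrict_Ici : expMeasure 1 ≤ volume.restrict (Set.Ici 0) := by
  have h : expMeasure 1 = volume.withDensity (exponentialPDF 1) := rfl
  rw [h, ← withDensity_indicator_one measurableSet_Ici]
  refine withDensity_mono (ae_of_all _ fun x => ?_)
  rw [exponentialPDF_eq]
  by_cases hx : 0 ≤ x
  · simp [hx]
  · simp [hx]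

lemma integral_exp_mul_sub_half_le {d : ℝ} (hd : 0 ≤ d) (l : ℝ) :
    ∫ x in (0 : ℝ)..d, Real.exp (l * (x - d / 2)) ≤ d * Real.exp (l ^ 2 * d ^ 2 / 8) := by
  have hc : Continuous fun x : ℝ => Real.exp (l * (x - d / 2)) := by fun_prop
  have hc' : Continuous fun x : ℝ => Real.exp (-(l * (x - d / 2))) := by fun_prop
  have hsym : ∫ x in (0 : ℝ)..d, Real.exp (l * (x - d / 2))
      = ∫ x in (0 : ℝ)..d, Real.exp (-(l * (x - d / 2))) := by
    have := intervalIntegral.integral_comp_sub_left (a := 0) (b := d)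
      (fun x : ℝ => Real.exp (l * (x - d / 2))) d
    rw [sub_self, sub_zero] at this
    rw [← this]
    congr 1; ext x; congr 1; ring
  -- Averaging with the reflection about `d / 2` removes the linear term, as in Hoeffding's lemma.
  have hcosh : ∫ x in (0 : ℝ)..d, Real.exp (l * (x - d / 2))
      = ∫ x in (0 : ℝ)..d, Real.cosh (l * (x - d / 2)) := by
    have h2 : ∫ x in (0 : ℝ)..d, Real.cosh (l * (x - d / 2))
        = ∫ x in (0 : ℝ)..d, (Real.exp (l * (x - d / 2)) + Real.exp (-(l * (x - d / 2)))) / 2 := by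
      simp only [Real.cosh_eq]
    rw [h2, intervalIntegral.integral_div, intervalIntegral.integral_add
      (hc.intervalIntegrable _ _) (hc'.intervalIntegrable _ _), ← hsym]
    ring
  rw [hcosh]
  have hmono : ∫ x in (0 : ℝ)..d, Real.cosh (l * (x - d / 2))
      ≤ ∫ _ in (0 : ℝ)..d, Real.exp (l ^ 2 * d ^ 2 / 8) := by
    refine intervalIntegral.integral_mono_on hd
      (Continuous.intervalIntegrable (by fun_prop) _ _)
      (Continuous.intervalIntegrable (by fun_prop) _ _) fun x hx => ?_
    refine (Real.cosh_le_exp_half_sq _).trans (Real.exp_le_exp.2 ?_)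
    have h1 : (x - d / 2) ^ 2 ≤ (d / 2) ^ 2 := by
      apply sq_le_sq'
      · linarith [hx.1]
      · linarith [hx.2]
    have h2 := mul_le_mul_of_nonneg_left h1 (sq_nonneg l)
    nlinarith
  simpa using hmono

lemma lintegral_exp_mul_sub_half_le {d : ℝ} (hd : 0 ≤ d) (l : ℝ) :
    ∫⁻ x in Set.Iic d, ENNReal.ofReal (Real.exp (l * (x - d / 2))) ∂(expMeasure 1)
      ≤ ENNReal.ofReal (d * Real.exp (l ^ 2 * d ^ 2 / 8)) := by
  have hc : Continuous fun x : ℝ => Real.exp (l * (x - d / 2)) := by fun_prop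
  calc ∫⁻ x in Set.Iic d, ENNReal.ofReal (Real.exp (l * (x - d / 2))) ∂(expMeasure 1)
      ≤ ∫⁻ x in Set.Iic d, ENNReal.ofReal (Real.exp (l * (x - d / 2)))
          ∂(volume.restrict (Set.Ici 0)) :=
        lintegral_mono' (Measure.restrict_mono le_rfl expMeasure_one_le_restrict_Ici) le_rfl
    _ = ∫⁻ x in Set.Icc 0 d, ENNReal.ofReal (Real.exp (l * (x - d / 2))) := by
        rw [Measure.restrict_restrict measurableSet_Iic, Set.inter_comm, Set.Ici_inter_Iic]
    _ = ENNReal.ofReal (∫ x in Set.Icc 0 d, Real.exp (l * (x - d / 2))) := by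
        rw [ofReal_integral_eq_lintegral_ofReal]
        · exact hc.continuousOn.integrableOn_compact isCompact_Icc
        · exact ae_of_all _ fun x => (Real.exp_pos _).le
    _ ≤ _ := by
        refine ENNReal.ofReal_le_ofReal ?_
        rw [integral_Icc_eq_integral_Ioc, ← intervalIntegral.integral_of_le hd]
        exact integral_exp_mul_sub_half_le hd l

/-! ### Chernoff bound for truncated sums -/

section Tail

variable {Ω ι : Type*} [MeasurableSpace Ω] {μ : Measure Ω} {X : ι → Ω → ℝ}

lemma measure_forall_mem_eq_prod (hX : ∀ j, Measurable (X j)) (hind : iIndepFun X μ)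
    (R : Finset ι) {s : ι → Set ℝ} (hs : ∀ j, MeasurableSet (s j)) :
    μ {ω | ∀ j ∈ R, X j ω ∈ s j} = ∏ j ∈ R, (μ.map (X j)) (s j) := by
  have h : {ω | ∀ j ∈ R, X j ω ∈ s j} = ⋂ j ∈ R, X j ⁻¹' s j := by
    ext ω; simp
  rw [h, hind.meas_biInter fun j _ => ⟨s j, hs j, rfl⟩]
  exact Finset.prod_congr rfl fun j _ => (Measure.map_apply (hX j) (hs j)).symm

/-- Exponential Markov inequality with the truncation built into the test function. The sign of `l`
is free, so both tails are covered. -/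
lemma measure_forall_le_and_le_sum_le (hX : ∀ j, Measurable (X j))
    (hlaw : ∀ j, μ.map (X j) = expMeasure 1) (hind : iIndepFun X μ) (R : Finset ι)
    {d : ℝ} (hd : 0 ≤ d) (l c : ℝ) :
    μ {ω | (∀ j ∈ R, X j ω ≤ d) ∧ c ≤ ∑ j ∈ R, l * (X j ω - d / 2)}
      ≤ ENNReal.ofReal (Real.exp (-c) * (d * Real.exp (l ^ 2 * d ^ 2 / 8)) ^ R.card) := by
  set f : ℝ → ENNReal :=
    (Set.Iic d).indicator fun x => ENNReal.ofReal (Real.exp (l * (x - d / 2))) with hf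
  have hfm : Measurable f := Measurable.indicator (by fun_prop) measurableSet_Iic
  have hprod : ∫⁻ ω, ∏ j ∈ R, f (X j ω) ∂μ
      ≤ ENNReal.ofReal (d * Real.exp (l ^ 2 * d ^ 2 / 8)) ^ R.card := by
    rw [lintegral_prod_eq_prod_lintegral_of_indepFun R (fun j ω => f (X j ω))
      (hind.comp (fun _ => f) fun _ => hfm) fun j => hfm.comp (hX j)]
    refine Finset.prod_le_pow_card _ _ _ fun j _ => ?_
    rw [← lintegral_map hfm (hX j), hlaw j, hf, lintegral_indicator measurableSet_Iic]
    exact lintegral_exp_mul_sub_half_le hd l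
  calc μ {ω | (∀ j ∈ R, X j ω ≤ d) ∧ c ≤ ∑ j ∈ R, l * (X j ω - d / 2)}
      ≤ μ {ω | 1 ≤ ENNReal.ofReal (Real.exp (-c)) * ∏ j ∈ R, f (X j ω)} := by
        refine measure_mono fun ω hω => ?_
        have h1 : ∏ j ∈ R, f (X j ω)
            = ENNReal.ofReal (Real.exp (∑ j ∈ R, l * (X j ω - d / 2))) := by
          rw [Real.exp_sum, ENNReal.ofReal_prod_of_nonneg fun j _ => (Real.exp_pos _).le]
          refine Finset.prod_congr rfl fun j hj => ?_
          rw [hf, Set.indicator_of_mem (show X j ω ∈ Set.Iic d from hω.1 j hj)]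
        rw [Set.mem_ofPred_eq, h1, ← ENNReal.ofReal_mul (Real.exp_pos _).le, ← Real.exp_add,
          ENNReal.one_le_ofReal, Real.one_le_exp_iff]
        linarith [hω.2]
    _ ≤ ∫⁻ ω, ENNReal.ofReal (Real.exp (-c)) * ∏ j ∈ R, f (X j ω) ∂μ := by
        have hm : Measurable fun ω =>
            ENNReal.ofReal (Real.exp (-c)) * ∏ j ∈ R, f (X j ω) :=
          (Finset.measurable_fun_prod R fun j _ => hfm.comp (hX j)).const_mul _
        simpa using mul_meas_ge_le_lintegral hm (μ := μ) 1
    _ ≤ _ := by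
        have hm : Measurable fun ω => ∏ j ∈ R, f (X j ω) :=
          Finset.measurable_fun_prod R fun j _ => hfm.comp (hX j)
        rw [lintegral_const_mul _ hm, ENNReal.ofReal_mul (Real.exp_pos _).le, ENNReal.ofReal_pow (by positivity)]
        gcongr

/-- Converts the Lebesgue length `d` back into the probability of `[0, d]`, so that the Chernoff
bound becomes relative to the truncation event. -/
lemma le_one_sub_exp_neg_mul_exp (d : ℝ) : d ≤ (1 - Real.exp (-d)) * Real.exp d := by
  have h1 : Real.exp (-d) * Real.exp d = 1 := by rw [← Real.exp_add]; simp
  have := Real.add_one_le_exp d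
  linarith

/-- Chernoff bound for a sum of exponential variables, relative to the event that none of them
exceeds `d`. -/
lemma measure_forall_le_and_lt_abs_sum_le (hX : ∀ j, Measurable (X j))
    (hlaw : ∀ j, μ.map (X j) = expMeasure 1) (hind : iIndepFun X μ) (R : Finset ι)
    {d : ℝ} (hd : 0 ≤ d) {l : ℝ} (hl : 0 ≤ l) (t : ℝ) :
    μ {ω | (∀ j ∈ R, X j ω ≤ d) ∧ t < |∑ j ∈ R, X j ω - R.card * (d / 2)|}
      ≤ ENNReal.ofReal (2 * Real.exp (R.card * (d + l ^ 2 * d ^ 2 / 8) - l * t))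
        * μ {ω | ∀ j ∈ R, X j ω ≤ d} := by
  have hrow : μ {ω | ∀ j ∈ R, X j ω ≤ d}
      = ENNReal.ofReal ((1 - Real.exp (-d)) ^ R.card) := by
    have := measure_forall_mem_eq_prod hX hind R (s := fun _ => Set.Iic d)
      fun _ => measurableSet_Iic
    simp only [Set.mem_Iic, hlaw, expMeasure_Iic one_pos hd, Finset.prod_const, one_mul] at this
    rw [this, ENNReal.ofReal_pow]
    rw [sub_nonneg, Real.exp_le_one_iff]
    linarith
  have hs : 0 ≤ 1 - Real.exp (-d) := by
    rw [sub_nonneg, Real.exp_le_one_iff]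
    linarith
  have hpow : (d * Real.exp (l ^ 2 * d ^ 2 / 8)) ^ R.card
      ≤ Real.exp (R.card * (d + l ^ 2 * d ^ 2 / 8)) * (1 - Real.exp (-d)) ^ R.card := by
    rw [Real.exp_nat_mul, ← mul_pow (Real.exp _)]
    gcongr ?_ ^ _
    rw [Real.exp_add]
    have := mul_le_mul_of_nonneg_right (le_one_sub_exp_neg_mul_exp d)
      (Real.exp_pos (l ^ 2 * d ^ 2 / 8)).le
    linarith
  -- Only the square of the tilt enters; `a = l` and `a = -l` give the two tails and the factor 2.
  have hside : ∀ a : ℝ, a ^ 2 = l ^ 2 →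
      μ {ω | (∀ j ∈ R, X j ω ≤ d) ∧ l * t ≤ ∑ j ∈ R, a * (X j ω - d / 2)}
        ≤ ENNReal.ofReal (Real.exp (R.card * (d + l ^ 2 * d ^ 2 / 8) - l * t)
          * (1 - Real.exp (-d)) ^ R.card) := by
    intro a ha
    refine (measure_forall_le_and_le_sum_le hX hlaw hind R hd a (l * t)).trans
      (ENNReal.ofReal_le_ofReal ?_)
    rw [ha, sub_eq_neg_add, Real.exp_add, mul_assoc]
    exact mul_le_mul_of_nonneg_left hpow (Real.exp_pos _).le
  rw [hrow, ← ENNReal.ofReal_mul (by positivity), mul_assoc, two_mul,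
    ENNReal.ofReal_add (by positivity) (by positivity)]
  refine le_trans (measure_mono ?_) ((measure_union_le _ _).trans
    (add_le_add (hside l rfl) (hside (-l) (by ring))))
  intro ω hω
  have hsum : ∑ j ∈ R, (X j ω - d / 2) = ∑ j ∈ R, X j ω - R.card * (d / 2) := by
    rw [Finset.sum_sub_distrib, Finset.sum_const, nsmul_eq_mul]
  rcases lt_abs.1 hω.2 with h | h
  · refine Or.inl ⟨hω.1, ?_⟩
    rw [← Finset.mul_sum, hsum]
    exact mul_le_mul_of_nonneg_left h.le hl
  · refine Or.inr ⟨hω.1, ?_⟩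
    rw [← Finset.mul_sum, hsum, neg_mul, ← mul_neg]
    exact mul_le_mul_of_nonneg_left h.le hl

end Tail

/-! ### Interference at a clique vertex, given the graph -/

lemma indepFun_ite_mem {Ω ι : Type*} [Fintype ι] [DecidableEq ι] [MeasurableSpace Ω] {μ : Measure Ω}
    {X : ι → Ω → ℝ} (hX : ∀ j, Measurable (X j)) (hind : iIndepFun X μ) (F : Finset ι) (d : ℝ) :
    IndepFun (fun ω p => if p ∈ F then X p ω else d) (fun ω p => if p ∈ F then d else X p ω) μ := by
  have h := hind.indepFun_finset F Fᶜ disjoint_compl_right hX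
  have h1 : Measurable fun (x : F → ℝ) (p : ι) => if h : p ∈ F then x ⟨p, h⟩ else d := by
    refine measurable_pi_lambda _ fun p => ?_
    by_cases hp : p ∈ F
    · simp only [hp, dite_true]; fun_prop
    · simp only [hp, dite_false]; fun_prop
  have h2 : Measurable fun (x : (Fᶜ : Finset ι) → ℝ) (p : ι) =>
      if h : p ∈ Fᶜ then x ⟨p, h⟩ else d := by
    refine measurable_pi_lambda _ fun p => ?_
    by_cases hp : p ∈ Fᶜ
    · simp only [hp, dite_true]; fun_prop
    · simp only [hp, dite_false]; fun_prop
  convert h.comp h1 h2 using 1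
  · ext ω p
    by_cases hp : p ∈ F <;> simp [hp]
  · ext ω p
    by_cases hp : p ∈ F <;> simp [hp]

namespace RayleighNetwork

variable {n : ℕ} {Δ δ : ℝ}

lemma mem_phaseOne {g : Fin n → Fin n → ℝ} {i : Fin n} : i ∈ phaseOne Δ g ↔ Δ < g i i := by
  simp [phaseOne]

lemma compatGraph_eq_iff {g : Fin n → Fin n → ℝ} {H : (⊤ : SimpleGraph (Fin n)).Subgraph} :
    compatGraph Δ δ g = H ↔ (∀ i, i ∈ H.verts ↔ Δ < g i i) ∧
      ∀ i j, H.Adj i j ↔ Δ < g i i ∧ Δ < g j j ∧ i ≠ j ∧ g i j ≤ δ ∧ g j i ≤ δ := by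
  constructor
  · rintro rfl
    simp [compatGraph, mem_phaseOne]
  · rintro ⟨h1, h2⟩
    refine SimpleGraph.Subgraph.ext ?_ ?_
    · ext i
      simp [compatGraph, mem_phaseOne, h1]
    · ext i j
      simp [compatGraph, mem_phaseOne, h2]

lemma measurableSet_compatGraph_eq (Δ δ : ℝ) (H : (⊤ : SimpleGraph (Fin n)).Subgraph) :
    MeasurableSet {g : Fin n → Fin n → ℝ | compatGraph Δ δ g = H} := by
  simp only [compatGraph_eq_iff]
  have hm : ∀ i j : Fin n, Measurable fun g : Fin n → Fin n → ℝ => g i j := fun i j => by fun_prop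
  have h1 : ∀ i, Measurable fun g : Fin n → Fin n → ℝ => Δ < g i i := fun i =>
    measurableSet_setOfPred.1 (measurableSet_lt measurable_const (hm i i))
  have h2 : ∀ i j, Measurable fun g : Fin n → Fin n → ℝ => g i j ≤ δ := fun i j =>
    measurableSet_setOfPred.1 (measurableSet_le (hm i j) measurable_const)
  refine measurableSet_setOfPred.2 (Measurable.and (Measurable.forall fun i => ?_)
    (Measurable.forall fun i => Measurable.forall fun j => ?_))
  · exact measurable_const.iff (h1 i)
  · exact measurable_const.iff
      ((h1 i).and ((h1 j).and (measurable_const.and ((h2 i j).and (h2 j i)))))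

/-- The graph sees a cross coefficient only through the comparison with `δ`, so entries known to be
at most `δ` may be overwritten by `δ` itself. This separates the event into a condition on the block
`R ×ˢ {i}` and one on the other coefficients. Since `i ∉ R`, the block avoids the diagonal, which
determines the vertices. -/
lemma compatGraph_eq_iff_of_adj {g : Fin n → Fin n → ℝ}
    {H : (⊤ : SimpleGraph (Fin n)).Subgraph} {R : Finset (Fin n)} {i : Fin n} (hi : i ∉ R)
    (hadj : ∀ j ∈ R, H.Adj j i) :
    compatGraph Δ δ g = H ↔ (∀ j ∈ R, g j i ≤ δ) ∧
      compatGraph Δ δ (fun a b => if (a, b) ∈ R ×ˢ {i} then δ else g a b) = H := by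
  have key : (∀ j ∈ R, g j i ≤ δ) →
      compatGraph Δ δ (fun a b => if (a, b) ∈ R ×ˢ {i} then δ else g a b) = compatGraph Δ δ g := by
    intro h
    have hdiag : ∀ a, (if (a, a) ∈ R ×ˢ {i} then δ else g a a) = g a a := by
      intro a
      rw [if_neg]
      simp only [Finset.mem_product, Finset.mem_singleton, not_and]
      rintro ha rfl
      exact hi ha
    have hoff : ∀ a b, (if (a, b) ∈ R ×ˢ {i} then δ else g a b) ≤ δ ↔ g a b ≤ δ := by
      intro a b
      split_ifs with hab
      · simp only [Finset.mem_product, Finset.mem_singleton] at hab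
        obtain ⟨ha, rfl⟩ := hab
        simp [h a ha]
      · rfl
    rw [compatGraph_eq_iff]
    simp only [hdiag, hoff]
    exact compatGraph_eq_iff.1 rfl
  constructor
  · intro h
    have h1 : ∀ j ∈ R, g j i ≤ δ := fun j hj =>
      (((compatGraph_eq_iff.1 h).2 j i).1 (hadj j hj)).2.2.2.1
    exact ⟨h1, (key h1).trans h⟩
  · rintro ⟨h1, h2⟩
    exact (key h1).symm.trans h2

variable {Ω : Type*} [MeasurableSpace Ω] {μ : Measure Ω} {g : Ω → Fin n → Fin n → ℝ}

lemma IsRayleighFading.measurable_fun (hg : IsRayleighFading μ g) : Measurable g :=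
  measurable_pi_lambda _ fun j => measurable_pi_lambda _ fun i => hg.measurable j i

lemma IsRayleighFading.iIndepFun_column (hg : IsRayleighFading μ g) (i : Fin n) :
    iIndepFun (fun j ω => g ω j i) μ :=
  hg.indep.precomp (g := fun j => (j, i)) fun _ _ h => (Prod.ext_iff.1 h).1

/-- Given the compatibility graph, the interference at a vertex of a clique concentrates. -/
lemma IsRayleighFading.measure_compatGraph_eq_and_lt_abs_le (hg : IsRayleighFading μ g)
    (hδ : 0 ≤ δ) {H : (⊤ : SimpleGraph (Fin n)).Subgraph} {R : Finset (Fin n)} {i : Fin n}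
    (hi : i ∉ R) (hadj : ∀ j ∈ R, H.Adj j i) {l : ℝ} (hl : 0 ≤ l) (t : ℝ) :
    μ {ω | compatGraph Δ δ (g ω) = H ∧ t < |∑ j ∈ R, g ω j i - R.card * (δ / 2)|}
      ≤ ENNReal.ofReal (2 * Real.exp (R.card * (δ + l ^ 2 * δ ^ 2 / 8) - l * t))
        * μ {ω | compatGraph Δ δ (g ω) = H} := by
  have hind := indepFun_ite_mem (fun p : Fin n × Fin n => hg.measurable p.1 p.2) hg.indep
    (R ×ˢ {i}) δ
  set C : Set (Fin n × Fin n → ℝ) :=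
    {x | compatGraph Δ δ (fun a b => x (a, b)) = H} with hC
  set B : Set (Fin n × Fin n → ℝ) := {x | ∀ j ∈ R, x (j, i) ≤ δ} with hB
  set D : Set (Fin n × Fin n → ℝ) :=
    {x | t < |∑ j ∈ R, x (j, i) - R.card * (δ / 2)|} with hD
  have hCm : MeasurableSet C := by
    have : Measurable fun (x : Fin n × Fin n → ℝ) (a b : Fin n) => x (a, b) := by fun_prop
    exact this (measurableSet_compatGraph_eq Δ δ H)
  have hBm : MeasurableSet B := by
    refine measurableSet_setOfPred.2 (Measurable.forall fun j => Measurable.forall fun _ => ?_)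
    exact measurableSet_setOfPred.1 (measurableSet_le (by fun_prop) measurable_const)
  have hDm : MeasurableSet D := measurableSet_lt measurable_const (by fun_prop)
  have hsum : ∀ ω, ∑ j ∈ R, (if j ∈ R then g ω j i else δ) = ∑ j ∈ R, g ω j i := fun ω =>
    Finset.sum_congr rfl fun j hj => if_pos hj
  have hall : ∀ ω, (∀ j ∈ R, (if j ∈ R then g ω j i else δ) ≤ δ) ↔ ∀ j ∈ R, g ω j i ≤ δ :=
    fun ω => forall₂_congr fun j hj => by rw [if_pos hj]
  have h1 : {ω | compatGraph Δ δ (g ω) = H ∧ t < |∑ j ∈ R, g ω j i - R.card * (δ / 2)|}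
      = (fun ω p => if p ∈ R ×ˢ {i} then g ω p.1 p.2 else δ) ⁻¹' (B ∩ D) ∩
        (fun ω p => if p ∈ R ×ˢ {i} then δ else g ω p.1 p.2) ⁻¹' C := by
    ext ω
    rw [Set.mem_ofPred_eq, compatGraph_eq_iff_of_adj hi hadj]
    simp only [Set.mem_ofPred_eq, Set.mem_inter_iff, Set.mem_preimage, hB, hC, hD, Finset.mem_product, Finset.mem_singleton, and_true,
      hsum, hall]
    tauto
  have h2 : {ω | compatGraph Δ δ (g ω) = H}
      = (fun ω p => if p ∈ R ×ˢ {i} then g ω p.1 p.2 else δ) ⁻¹' B ∩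
        (fun ω p => if p ∈ R ×ˢ {i} then δ else g ω p.1 p.2) ⁻¹' C := by
    ext ω
    rw [Set.mem_ofPred_eq, compatGraph_eq_iff_of_adj hi hadj]
    simp only [Set.mem_ofPred_eq, Set.mem_inter_iff, Set.mem_preimage, hB, hC, Finset.mem_product, Finset.mem_singleton, and_true, hall]
  -- Both sides carry the same factor for the coefficients outside the block; what remains is the
  -- relative Chernoff bound.
  rw [h1, h2, hind.measure_inter_preimage_eq_mul _ _ (hBm.inter hDm) hCm,
    hind.measure_inter_preimage_eq_mul _ _ hBm hCm, ← mul_assoc]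
  gcongr
  have h3 : (fun ω p => if p ∈ R ×ˢ {i} then g ω p.1 p.2 else δ) ⁻¹' (B ∩ D)
      = {ω | (∀ j ∈ R, g ω j i ≤ δ) ∧ t < |∑ j ∈ R, g ω j i - R.card * (δ / 2)|} := by
    ext ω
    simp only [Set.mem_ofPred_eq, Set.mem_inter_iff, Set.mem_preimage, hB, hD,
      Finset.mem_product, Finset.mem_singleton, and_true, hsum, hall]
  have h4 : (fun ω p => if p ∈ R ×ˢ {i} then g ω p.1 p.2 else δ) ⁻¹' B
      = {ω | ∀ j ∈ R, g ω j i ≤ δ} := by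
    ext ω
    simp only [Set.mem_ofPred_eq, Set.mem_preimage, hB,
      Finset.mem_product, Finset.mem_singleton, and_true, hall]
  rw [h3, h4]
  exact measure_forall_le_and_lt_abs_sum_le (fun j => hg.measurable j i)
    (fun j => hg.law j i) (hg.iIndepFun_column i) R hδ hl t

end RayleighNetwork

/-! ### From a fixed clique to the selected one -/

namespace RayleighNetwork

variable {n : ℕ} {Δ δ : ℝ} {Ω : Type*} [MeasurableSpace Ω] {μ : Measure Ω}
  {g : Ω → Fin n → Fin n → ℝ} {A : Ω → Finset (Fin n)}

lemma measurableSet_comap_crossGains_exists_lt_abs {Ω' : Type*} (g : Ω' → Fin n → Fin n → ℝ)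
    (S : Finset (Fin n)) (t : ℝ) (c : Fin n → ℝ) :
    MeasurableSet[MeasurableSpace.comap (fun ω => crossGains (g ω)) inferInstance]
      {ω | ∃ i ∈ S, t < |interference (g ω) S i - c i|} := by
  -- The default 0 on the diagonal is never read: the interference at `i` omits `j = i`.
  refine ⟨{x | ∃ i ∈ S, t < |interference
    (fun a b => if h : a ≠ b then x ⟨(a, b), h⟩ else 0) S i - c i|}, ?_, ?_⟩
  · refine measurableSet_setOfPred.2 (Measurable.exists fun i => Measurable.and measurable_const
      (measurableSet_setOfPred.1 (measurableSet_lt measurable_const ?_)))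
    have hm : Measurable fun x : {p : Fin n × Fin n // p.1 ≠ p.2} → ℝ =>
        interference (fun a b => if h : a ≠ b then x ⟨(a, b), h⟩ else 0) S i := by
      refine Finset.measurable_fun_sum _ fun j _ => ?_
      by_cases hji : j ≠ i
      · simp only [dif_pos hji]; fun_prop
      · simp only [dif_neg hji]; fun_prop
    exact (hm.sub_const _).abs
  · have hI : ∀ ω i, interference
        (fun a b => if h : a ≠ b then crossGains (g ω) ⟨(a, b), h⟩ else 0) S i
          = interference (g ω) S i := fun ω i =>
      Finset.sum_congr rfl fun j hj => dif_pos (Finset.ne_of_mem_erase hj)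
    ext ω
    simp only [Set.mem_preimage, Set.mem_ofPred_eq, hI]

lemma adj_of_isAdmissible {f : Fin n → Fin n → ℝ} {S : Finset (Fin n)}
    (h : IsAdmissible Δ δ f S) {i j : Fin n} (hi : i ∈ S) (hj : j ∈ S) (hij : j ≠ i) :
    (compatGraph Δ δ f).Adj j i :=
  ⟨h.1 hj, h.1 hi, hij, h.2 j hj i hi hij⟩

lemma IsDTBLAS.measure_outcome_eq_and_exists_lt_abs_le [IsProbabilityMeasure μ]
    (hg : IsRayleighFading μ g) (hA : IsDTBLAS μ g Δ δ A) (hδ : 0 ≤ δ)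
    {l : ℝ} (hl : 0 ≤ l) (t : ℝ) (K : ℕ) (H : (⊤ : SimpleGraph (Fin n)).Subgraph)
    {S : Finset (Fin n)} (hS : S.card ≤ K) :
    μ ({ω | compatGraph Δ δ (g ω) = H} ∩ (A ⁻¹' {S} ∩
        {ω | ∃ i ∈ S, t < |interference (g ω) S i - (S.erase i).card * (δ / 2)|}))
      ≤ K * ENNReal.ofReal (2 * Real.exp (K * (δ + l ^ 2 * δ ^ 2 / 8) - l * t))
        * μ ({ω | compatGraph Δ δ (g ω) = H} ∩ A ⁻¹' {S}) := by
  set E := {ω | compatGraph Δ δ (g ω) = H} with hE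
  set B := {ω | ∃ i ∈ S, t < |interference (g ω) S i - (S.erase i).card * (δ / 2)|} with hB
  set κ := ENNReal.ofReal (2 * Real.exp (K * (δ + l ^ 2 * δ ^ 2 / 8) - l * t)) with hκ
  have hEm : MeasurableSet E := hg.measurable_fun (measurableSet_compatGraph_eq Δ δ H)
  -- One sample point with graph `H` and outcome `S` certifies that `S` is a clique of `H`, a fact
  -- about `H` alone.
  rcases Set.eq_empty_or_nonempty (E ∩ A ⁻¹' {S}) with he | ⟨ω₀, hω₀, hAω₀⟩
  · rw [← Set.inter_assoc, he, Set.empty_inter, measure_empty]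
    exact zero_le
  have hadm : IsAdmissible Δ δ (g ω₀) S := by
    have := (hA.outcome ω₀).1
    rwa [show A ω₀ = S from hAω₀] at this
  have hEB : μ (E ∩ B) ≤ K * κ * μ E := by
    calc μ (E ∩ B) ≤ μ (⋃ i ∈ S, {ω | compatGraph Δ δ (g ω) = H ∧
            t < |∑ j ∈ S.erase i, g ω j i - (S.erase i).card * (δ / 2)|}) := by
          refine measure_mono ?_
          rintro ω ⟨h1, i, hi, h2⟩
          exact Set.mem_biUnion hi ⟨h1, h2⟩
      _ ≤ ∑ i ∈ S, κ * μ E := by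
          refine (measure_biUnion_finset_le _ _).trans (Finset.sum_le_sum fun i hi => ?_)
          refine (hg.measure_compatGraph_eq_and_lt_abs_le hδ (Finset.notMem_erase i S)
            (fun j hj => ?_) hl t).trans ?_
          · rw [← show compatGraph Δ δ (g ω₀) = H from hω₀]
            exact adj_of_isAdmissible hadm hi (Finset.mem_of_mem_erase hj)
              (Finset.ne_of_mem_erase hj)
          · rw [hκ]
            gcongr
            exact (Finset.card_le_card (Finset.erase_subset _ _)).trans hS
      _ ≤ K * κ * μ E := by
          rw [Finset.sum_const, nsmul_eq_mul, ← mul_assoc]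
          gcongr
  by_cases hE0 : μ E = 0
  · rw [measure_mono_null Set.inter_subset_left hE0]
    exact zero_le
  -- Given `H`, selecting `S` does not bias the deviation event, so the bound for `E ∩ B` transfers.
  have hind := (Indep_iff _ _ _).1 (hA.graph_based H) (A ⁻¹' {S}) B ⟨{S}, trivial, rfl⟩
    (measurableSet_comap_crossGains_exists_lt_abs g S t _)
  have hEt : μ E ≠ ⊤ := measure_ne_top μ E
  rw [cond_apply hEm, cond_apply hEm, cond_apply hEm] at hind
  calc μ (E ∩ (A ⁻¹' {S} ∩ B)) = μ E * ((μ E)⁻¹ * μ (E ∩ (A ⁻¹' {S} ∩ B))) := by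
        rw [← mul_assoc, ENNReal.mul_inv_cancel hE0 hEt, one_mul]
    _ = (μ E * (μ E)⁻¹) * (μ (E ∩ A ⁻¹' {S}) * ((μ E)⁻¹ * μ (E ∩ B))) := by
        rw [hind]; ring
    _ ≤ (μ E * (μ E)⁻¹) * (μ (E ∩ A ⁻¹' {S}) * ((μ E)⁻¹ * (K * κ * μ E))) := by
        gcongr
    _ = (μ E * (μ E)⁻¹) * (μ E * (μ E)⁻¹) * (K * κ * μ (E ∩ A ⁻¹' {S})) := by ring
    _ = K * κ * μ (E ∩ A ⁻¹' {S}) := by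
        rw [ENNReal.mul_inv_cancel hE0 hEt, one_mul, one_mul]

/-- The interference of all active links concentrates, unless there are more than `K` of them. -/
lemma IsDTBLAS.measure_card_le_and_exists_lt_abs_le [IsProbabilityMeasure μ]
    (hg : IsRayleighFading μ g) (hA : IsDTBLAS μ g Δ δ A) (hδ : 0 ≤ δ)
    {l : ℝ} (hl : 0 ≤ l) (t : ℝ) (K : ℕ) :
    μ {ω | (A ω).card ≤ K ∧ ∃ i ∈ A ω,
        t < |interference (g ω) (A ω) i - ((A ω).erase i).card * (δ / 2)|}
      ≤ K * ENNReal.ofReal (2 * Real.exp (K * (δ + l ^ 2 * δ ^ 2 / 8) - l * t)) := by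
  classical
  have := Fintype.ofFinite (⊤ : SimpleGraph (Fin n)).Subgraph
  set κ := ENNReal.ofReal (2 * Real.exp (K * (δ + l ^ 2 * δ ^ 2 / 8) - l * t)) with hκ
  set F : Ω → (⊤ : SimpleGraph (Fin n)).Subgraph × Finset (Fin n) :=
    fun ω => (compatGraph Δ δ (g ω), A ω) with hF
  have hfib : ∀ H S, F ⁻¹' {(H, S)} = {ω | compatGraph Δ δ (g ω) = H} ∩ A ⁻¹' {S} := by
    intro H S; ext ω; simp [hF]
  have hFm : ∀ y, MeasurableSet (F ⁻¹' {y}) := by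
    rintro ⟨H, S⟩
    rw [hfib]
    exact (hg.measurable_fun (measurableSet_compatGraph_eq Δ δ H)).inter
      (hA.measurable (t := {S}) trivial)
  set T : Finset ((⊤ : SimpleGraph (Fin n)).Subgraph × Finset (Fin n)) :=
    Finset.univ.filter fun y => y.2.card ≤ K with hT
  calc _ ≤ μ (⋃ y ∈ T, {ω | compatGraph Δ δ (g ω) = y.1} ∩ (A ⁻¹' {y.2} ∩
        {ω | ∃ i ∈ y.2, t < |interference (g ω) y.2 i - (y.2.erase i).card * (δ / 2)|})) := by
        refine measure_mono ?_
        rintro ω ⟨h1, h2⟩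
        exact Set.mem_biUnion (x := F ω) (by simpa [hT, hF] using h1) ⟨rfl, rfl, h2⟩
    _ ≤ ∑ y ∈ T, K * κ * μ (F ⁻¹' {y}) := by
        refine (measure_biUnion_finset_le _ _).trans (Finset.sum_le_sum fun y hy => ?_)
        rw [hfib]
        exact hA.measure_outcome_eq_and_exists_lt_abs_le hg hδ hl t K y.1
          (by simpa [hT] using hy)
    -- The fibres of (graph, choice) are disjoint, so their total mass is at most one: no factor for
    -- the number of cliques.
    _ = K * κ * μ (F ⁻¹' ↑T) := by
        rw [← Finset.mul_sum, sum_measure_preimage_singleton T fun y _ => hFm y]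
    _ ≤ K * κ * 1 := by
        gcongr
        exact prob_le_one
    _ = K * κ := mul_one _

end RayleighNetwork

/-! ### The number of active links: first and second moments -/

/-- The second moment method. -/
lemma measureReal_setOf_forall_notMem_le_of_second_moment {Ω α : Type*} [MeasurableSpace Ω]
    {μ : Measure Ω} [IsProbabilityMeasure μ] [Fintype α] {E : α → Set Ω}
    (hE : ∀ a, MeasurableSet (E a)) {M η : ℝ} (hM : 0 < M) (hfst : ∑ a, μ.real (E a) = M)
    (hsnd : ∑ a, ∑ b, μ.real (E a ∩ E b) ≤ (1 + η) * M ^ 2) :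
    μ.real {ω | ∀ a, ω ∉ E a} ≤ η := by
  set X : Ω → ℝ := fun ω => ∑ a, (E a).indicator 1 ω with hX
  have hint : ∀ a, Integrable ((E a).indicator (1 : Ω → ℝ)) μ := fun a =>
    (integrable_const (1 : ℝ)).indicator (hE a)
  have hXint : Integrable X μ := integrable_finsetSum _ fun a _ => hint a
  have hX1 : ∫ ω, X ω ∂μ = M := by
    rw [hX, integral_finsetSum _ fun a _ => hint a, ← hfst]
    exact Finset.sum_congr rfl fun a _ => integral_indicator_one (hE a)
  have hsq : ∀ ω, X ω ^ 2 = ∑ a, ∑ b, (E a ∩ E b).indicator (1 : Ω → ℝ) ω := by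
    intro ω
    rw [hX, sq, Finset.sum_mul_sum]
    simp only [Set.inter_indicator_one, Pi.mul_apply]
  have hint2 : ∀ a b, Integrable ((E a ∩ E b).indicator (1 : Ω → ℝ)) μ := fun a b =>
    (integrable_const (1 : ℝ)).indicator ((hE a).inter (hE b))
  have hX2int : Integrable (fun ω => X ω ^ 2) μ := by
    simp only [hsq]
    exact integrable_finsetSum _ fun a _ => integrable_finsetSum _ fun b _ => hint2 a b
  have hX2 : ∫ ω, X ω ^ 2 ∂μ ≤ (1 + η) * M ^ 2 := by
    simp only [hsq]
    rw [integral_finsetSum _ fun a _ => integrable_finsetSum _ fun b _ => hint2 a b]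
    refine le_trans (le_of_eq (Finset.sum_congr rfl fun a _ => ?_)) hsnd
    rw [integral_finsetSum _ fun b _ => hint2 a b]
    exact Finset.sum_congr rfl fun b _ => integral_indicator_one ((hE a).inter (hE b))
  have hYeq : ∀ ω, (X ω - M) ^ 2 = X ω ^ 2 - 2 * M * X ω + M ^ 2 := fun ω => by ring
  have hYint : Integrable (fun ω => (X ω - M) ^ 2) μ := by
    simp only [hYeq]
    exact (hX2int.sub (hXint.const_mul _)).add (integrable_const _)
  have hY : ∫ ω, (X ω - M) ^ 2 ∂μ ≤ η * M ^ 2 := by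
    simp only [hYeq]
    have hdiff : Integrable (fun ω => X ω ^ 2 - 2 * M * X ω) μ := hX2int.sub (hXint.const_mul _)
    rw [integral_add hdiff (integrable_const _), integral_sub hX2int (hXint.const_mul _), integral_const_mul, hX1, integral_const]
    simp only [probReal_univ, one_smul]
    linarith
  have hmarkov := mul_meas_ge_le_integral_of_nonneg
    (ae_of_all μ fun ω => sq_nonneg (X ω - M)) hYint (M ^ 2)
  have hsub : {ω | ∀ a, ω ∉ E a} ⊆ {ω | M ^ 2 ≤ (X ω - M) ^ 2} := by
    intro ω hω
    have : X ω = 0 := Finset.sum_eq_zero fun a _ => Set.indicator_of_notMem (hω a) _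
    simp [this]
  have hle := measureReal_mono hsub (μ := μ)
  have hM2 : 0 < M ^ 2 := by positivity
  refine le_of_mul_le_mul_left ?_ hM2
  calc _ ≤ M ^ 2 * μ.real {ω | M ^ 2 ≤ (X ω - M) ^ 2} := by gcongr
    _ ≤ _ := hmarkov.trans (hY.trans_eq (mul_comm _ _))

/-- Each row has one diagonal entry. For empty `U` the truncated exponent is harmless, as the outer
power is zero. -/
lemma prod_product_self_ite_eq {α : Type*} [DecidableEq α] (U : Finset α) (q s : ℝ) :
    ∏ p ∈ U ×ˢ U, (if p.1 = p.2 then q else s) = (q * s ^ (U.card - 1)) ^ U.card := by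
  rw [Finset.prod_product, ← Finset.prod_const]
  refine Finset.prod_congr rfl fun a ha => ?_
  rw [← Finset.mul_prod_erase U _ ha, if_pos rfl, ← Finset.card_erase_of_mem ha,
    ← Finset.prod_const]
  congr 1
  exact Finset.prod_congr rfl fun b hb => if_neg (Finset.ne_of_mem_erase hb).symm

/-- The sum factors over coordinates, each with one agreeing value and `m - 1` others. It serves as
the generating function for overlaps of transversals. -/
lemma sum_pow_card_filter_eq {k m : ℕ} (f : Fin k → Fin m) (y : ℝ) :
    ∑ h : Fin k → Fin m, y ^ (Finset.univ.filter fun i => f i = h i).card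
      = (m - 1 + y) ^ k := by
  have h1 : ∀ i, ∑ b : Fin m, (if f i = b then y else 1) = m - 1 + y := by
    intro i
    rw [← Finset.add_sum_erase _ _ (Finset.mem_univ (f i)), if_pos rfl,
      Finset.sum_congr rfl fun b hb => if_neg (Finset.ne_of_mem_erase hb).symm,
      Finset.sum_const, Finset.card_erase_of_mem (Finset.mem_univ _), Finset.card_univ,
      Fintype.card_fin, nsmul_one, Nat.cast_pred (f i).pos]
    ring
  have h2 := Finset.prod_univ_sum (fun _ : Fin k => (Finset.univ : Finset (Fin m)))
    fun i b => if f i = b then y else 1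
  simp only [h1, Fintype.piFinset_univ, Finset.prod_const, Finset.card_univ,
    Fintype.card_fin] at h2
  rw [h2]
  refine Finset.sum_congr rfl fun h _ => ?_
  rw [Finset.prod_ite, Finset.prod_const, Finset.prod_const_one, mul_one]

namespace RayleighNetwork

variable {n : ℕ} {Δ δ : ℝ} {Ω : Type*} [MeasurableSpace Ω] {μ : Measure Ω}
  {g : Ω → Fin n → Fin n → ℝ} {A : Ω → Finset (Fin n)}

/-- Union bound over sets of exactly `M + 1` links, discarding the direct threshold. Each set has `M
* (M + 1)` ordered pairs, so bounding the binomial by `n ^ (M + 1)` gives an exact power. -/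
lemma IsRayleighFading.measure_le_card_le (hg : IsRayleighFading μ g)
    (hA : ∀ ω, IsAdmissible Δ δ (g ω) (A ω)) (hδ : 0 ≤ δ) (M : ℕ) :
    μ {ω | M + 1 ≤ (A ω).card}
      ≤ ENNReal.ofReal ((n * (1 - Real.exp (-δ)) ^ M) ^ (M + 1)) := by
  have hs : 0 ≤ 1 - Real.exp (-δ) := by
    rw [sub_nonneg, Real.exp_le_one_iff]
    linarith
  have hclique : ∀ S ∈ Finset.powersetCard (M + 1) (Finset.univ : Finset (Fin n)),
      μ {ω | ∀ p ∈ S.offDiag, g ω p.1 p.2 ∈ Set.Iic δ}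
        = ENNReal.ofReal ((1 - Real.exp (-δ)) ^ (M * (M + 1))) := by
    intro S hS
    have hcard : S.card = M + 1 := (Finset.mem_powersetCard.1 hS).2
    rw [measure_forall_mem_eq_prod (fun p : Fin n × Fin n => hg.measurable p.1 p.2) hg.indep
      S.offDiag fun _ => measurableSet_Iic]
    simp only [hg.law, expMeasure_Iic one_pos hδ, Finset.prod_const, one_mul]
    rw [← ENNReal.ofReal_pow hs, Finset.offDiag_card, hcard]
    congr 2
    rw [← Nat.sub_one_mul, Nat.add_sub_cancel]
  calc μ {ω | M + 1 ≤ (A ω).card}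
      ≤ μ (⋃ S ∈ Finset.powersetCard (M + 1) (Finset.univ : Finset (Fin n)),
          {ω | ∀ p ∈ S.offDiag, g ω p.1 p.2 ∈ Set.Iic δ}) := by
        refine measure_mono fun ω hω => ?_
        obtain ⟨S, hSA, hS⟩ := Finset.exists_subset_card_eq (show M + 1 ≤ (A ω).card from hω)
        refine Set.mem_biUnion (Finset.mem_powersetCard.2 ⟨Finset.subset_univ S, hS⟩) ?_
        intro p hp
        obtain ⟨h1, h2, h3⟩ := Finset.mem_offDiag.1 hp
        exact ((hA ω).2 _ (hSA h1) _ (hSA h2) h3).1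
    _ ≤ ∑ S ∈ Finset.powersetCard (M + 1) (Finset.univ : Finset (Fin n)),
          ENNReal.ofReal ((1 - Real.exp (-δ)) ^ (M * (M + 1))) :=
        (measure_biUnion_finset_le _ _).trans
          (Finset.sum_le_sum fun S hS => (hclique S hS).le)
    _ = ENNReal.ofReal (n.choose (M + 1) * (1 - Real.exp (-δ)) ^ (M * (M + 1))) := by
        rw [Finset.sum_const, Finset.card_powersetCard, Finset.card_univ, Fintype.card_fin,
          nsmul_eq_mul, ENNReal.ofReal_mul (Nat.cast_nonneg _), ENNReal.ofReal_natCast]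
    _ ≤ _ := by
        refine ENNReal.ofReal_le_ofReal ?_
        rw [mul_pow, ← pow_mul]
        gcongr
        exact_mod_cast Nat.choose_le_pow n (M + 1)

lemma measureReal_forall_mem_product_eq (hg : IsRayleighFading μ g) (hΔ : 0 ≤ Δ) (hδ : 0 ≤ δ)
    (F : Finset (Fin n × Fin n)) :
    μ.real {ω | ∀ p ∈ F, g ω p.1 p.2 ∈ if p.1 = p.2 then Set.Ioi Δ else Set.Iic δ}
      = ∏ p ∈ F, if p.1 = p.2 then Real.exp (-Δ) else 1 - Real.exp (-δ) := by
  have hs : 0 ≤ 1 - Real.exp (-δ) := by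
    rw [sub_nonneg, Real.exp_le_one_iff]
    linarith
  rw [measureReal_def, measure_forall_mem_eq_prod
    (s := fun p : Fin n × Fin n => if p.1 = p.2 then Set.Ioi Δ else Set.Iic δ)
    (fun p : Fin n × Fin n => hg.measurable p.1 p.2) hg.indep F
    (fun p => by split_ifs; exacts [measurableSet_Ioi, measurableSet_Iic]), ENNReal.toReal_prod]
  refine Finset.prod_congr rfl fun p _ => ?_
  rw [hg.law]
  split_ifs
  · rw [expMeasure_Ioi one_pos hΔ, ENNReal.toReal_ofReal (Real.exp_pos _).le, one_mul]
  · rw [expMeasure_Iic one_pos hδ, one_mul, ENNReal.toReal_ofReal hs]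

/-- A largest admissible set is unlikely to be small: second moment bound over the transversals of
`k` disjoint blocks of `m` links. -/
lemma IsRayleighFading.measureReal_card_lt_le [IsProbabilityMeasure μ]
    (hg : IsRayleighFading μ g) (hA : ∀ ω, IsDTBLASOutcome Δ δ (g ω) (A ω))
    (hΔ : 0 ≤ Δ) (hδ : 0 < δ) {k m : ℕ} (hm : 0 < m) (hkm : k * m ≤ n) :
    μ.real {ω | (A ω).card < k}
      ≤ Real.exp (k * (Real.exp (-Δ) * (1 - Real.exp (-δ)) ^ (k - 1))⁻¹ / m) - 1 := by
  set q := Real.exp (-Δ) with hq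
  set s := 1 - Real.exp (-δ) with hs
  have hq0 : 0 < q := Real.exp_pos _
  have hs0 : 0 < s := by
    rw [hs, sub_pos, Real.exp_lt_one_iff]
    linarith
  have hs1 : s ≤ 1 := by linarith [Real.exp_pos (-δ)]
  set y := (q * s ^ (k - 1))⁻¹ with hy
  have hy0 : 0 < y := by positivity
  -- With one link per block, two transversals can share links only within a common block; the
  -- overlap is the number of agreements of `f` and `h`, and the sum over pairs factors.
  obtain ⟨e⟩ : Nonempty (Fin k × Fin m ↪ Fin n) :=
    Function.Embedding.nonempty_of_card_le (by simpa using hkm)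
  set S : (Fin k → Fin m) → Finset (Fin n) := fun f =>
    Finset.univ.map ⟨fun i => e (i, f i), fun i j h => (Prod.ext_iff.1 (e.injective h)).1⟩ with hS
  have hScard : ∀ f, (S f).card = k := fun f => by simp [hS]
  have hSinter : ∀ f h, (S f ∩ S h).card = (Finset.univ.filter fun i => f i = h i).card := by
    intro f h
    have : S f ∩ S h = (Finset.univ.filter fun i => f i = h i).map
        ⟨fun i => e (i, f i), fun i j h => (Prod.ext_iff.1 (e.injective h)).1⟩ := by
      ext a
      simp only [hS, Finset.mem_inter, Finset.mem_map, Finset.mem_univ, true_and,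
        Finset.mem_filter]
      constructor
      · rintro ⟨⟨i, hi⟩, j, hj⟩
        have hij := e.injective (hi.trans hj.symm)
        obtain ⟨rfl, h2⟩ := Prod.ext_iff.1 hij
        exact ⟨i, h2, hi⟩
      · rintro ⟨i, h1, h2⟩
        refine ⟨⟨i, h2⟩, i, ?_⟩
        change e (i, h i) = a
        rw [← h1]
        exact h2
    rw [this, Finset.card_map]
  set G : Finset (Fin n × Fin n) → Set Ω := fun F =>
    {ω | ∀ p ∈ F, g ω p.1 p.2 ∈ if p.1 = p.2 then Set.Ioi Δ else Set.Iic δ} with hG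
  have hGm : ∀ F, MeasurableSet (G F) := by
    intro F
    refine measurableSet_setOfPred.2 (Measurable.forall fun p => Measurable.forall fun _ => ?_)
    have : MeasurableSet (if p.1 = p.2 then Set.Ioi Δ else Set.Iic δ) := by
      split_ifs; exacts [measurableSet_Ioi, measurableSet_Iic]
    exact measurableSet_setOfPred.1 (hg.measurable p.1 p.2 this)
  set P := (q * s ^ (k - 1)) ^ k with hP
  have hP0 : 0 < P := by positivity
  have hfst : ∀ f, μ.real (G (S f ×ˢ S f)) = P := by
    intro f
    rw [hG, measureReal_forall_mem_product_eq hg hΔ hδ.le, prod_product_self_ite_eq, hScard]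
  have hsnd : ∀ f h, μ.real (G (S f ×ˢ S f) ∩ G (S h ×ˢ S h))
      ≤ P ^ 2 * y ^ (Finset.univ.filter fun i => f i = h i).card := by
    intro f h
    have hunion : G (S f ×ˢ S f) ∩ G (S h ×ˢ S h) = G (S f ×ˢ S f ∪ S h ×ˢ S h) := by
      ext ω
      simp only [hG, Set.mem_inter_iff, Set.mem_ofPred_eq, Finset.mem_union, or_imp, forall_and]
    -- The joint probability times that of the common part equals `P ^ 2`; a lower bound on the
    -- latter, `y⁻¹` per shared link, bounds the correlation.
    have hprod := Finset.prod_union_inter (s₁ := S f ×ˢ S f) (s₂ := S h ×ˢ S h)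
      (f := fun p : Fin n × Fin n => if p.1 = p.2 then q else s)
    rw [Finset.product_inter_product, prod_product_self_ite_eq, prod_product_self_ite_eq,
      prod_product_self_ite_eq, hScard, hScard, hSinter, ← hP] at hprod
    set u := (Finset.univ.filter fun i => f i = h i).card with hu
    have huk : u ≤ k := by
      simpa using Finset.card_le_univ (Finset.univ.filter fun i => f i = h i)
    have hle : y⁻¹ ^ u ≤ (q * s ^ (u - 1)) ^ u := by
      rw [hy, inv_inv]
      have : s ^ (k - 1) ≤ s ^ (u - 1) := pow_le_pow_of_le_one hs0.le hs1 (by omega)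
      gcongr
    rw [hunion, hG, measureReal_forall_mem_product_eq hg hΔ hδ.le]
    set Z := ∏ p ∈ S f ×ˢ S f ∪ S h ×ˢ S h, (if p.1 = p.2 then q else s) with hZ
    have hZ0 : 0 ≤ Z := Finset.prod_nonneg fun p _ => by split_ifs <;> positivity
    have h1 : Z * y⁻¹ ^ u ≤ P ^ 2 := by
      rw [sq, ← hprod]
      gcongr
    rw [inv_pow] at h1
    rwa [mul_inv_le_iff₀ (by positivity)] at h1
  have hm' : (0 : ℝ) < m := by exact_mod_cast hm
  have key := measureReal_setOf_forall_notMem_le_of_second_moment (μ := μ)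
    (E := fun f => G (S f ×ˢ S f)) (fun f => hGm _) (M := (m : ℝ) ^ k * P)
    (η := Real.exp (k * y / m) - 1) (by positivity)
    (by simp only [hfst, Finset.sum_const, nsmul_eq_mul]; simp) ?_
  · refine le_trans (measureReal_mono ?_) key
    intro ω hω f hf
    have hadm : IsAdmissible Δ δ (g ω) (S f) := by
      refine ⟨fun i hi => mem_phaseOne.2 ?_, fun i hi j hj hij => ⟨?_, ?_⟩⟩
      · simpa using hf (i, i) (Finset.mk_mem_product hi hi)
      · simpa [hij] using hf (i, j) (Finset.mk_mem_product hi hj)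
      · simpa [hij.symm] using hf (j, i) (Finset.mk_mem_product hj hi)
    have := (hA ω).2 _ hadm
    rw [hScard] at this
    exact absurd hω (not_lt.2 this)
  · calc ∑ f, ∑ h, μ.real (G (S f ×ˢ S f) ∩ G (S h ×ˢ S h))
        ≤ ∑ f : Fin k → Fin m, ∑ h : Fin k → Fin m,
            P ^ 2 * y ^ (Finset.univ.filter fun i => f i = h i).card :=
          Finset.sum_le_sum fun f _ => Finset.sum_le_sum fun h _ => hsnd f h
      _ = (m : ℝ) ^ k * P ^ 2 * (m - 1 + y) ^ k := by
          simp only [← Finset.mul_sum, sum_pow_card_filter_eq, Finset.sum_const, nsmul_eq_mul]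
          simp
          ring
      _ ≤ (m : ℝ) ^ k * P ^ 2 * (m * Real.exp (y / m)) ^ k := by
          have h1 : (m : ℝ) - 1 + y ≤ m * Real.exp (y / m) := by
            have h2 := mul_le_mul_of_nonneg_left (Real.add_one_le_exp (y / m)) hm'.le
            rw [mul_add, mul_div_cancel₀ _ hm'.ne'] at h2
            linarith
          have h3 : (0 : ℝ) ≤ (m : ℝ) - 1 + y := by
            have : (1 : ℝ) ≤ m := by exact_mod_cast hm
            linarith
          gcongr
      _ = _ := by
          rw [mul_pow, ← Real.exp_nat_mul, mul_div_assoc]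
          ring

end RayleighNetwork

/-! ### Analytic tools and asymptotics of the thresholds -/

lemma abs_log_sub_log_le {c x y : ℝ} (hc : 0 < c) (hx : c ≤ x) (hy : c ≤ y) :
    |Real.log x - Real.log y| ≤ |x - y| / c := by
  have key : ∀ a b : ℝ, c ≤ a → c ≤ b → Real.log a - Real.log b ≤ |a - b| / c := by
    intro a b ha hb
    have ha0 : 0 < a := hc.trans_le ha
    have hb0 : 0 < b := hc.trans_le hb
    rw [← Real.log_div ha0.ne' hb0.ne']
    calc Real.log (a / b) ≤ a / b - 1 := Real.log_le_sub_one_of_pos (by positivity)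
      _ = (a - b) / b := by field_simp
      _ ≤ |a - b| / b := by gcongr; exact le_abs_self _
      _ ≤ |a - b| / c := by gcongr
  rw [abs_le]
  constructor
  · have := key y x hy hx
    rw [abs_sub_comm] at this
    linarith
  · exact key x y hx hy

/-- A family of antitone functions that tends to zero pointwise also does so along some sequence
that tends to zero. -/
lemma exists_tendsto_zero_of_antitone {F : ℕ → ℝ → ℝ} (hanti : ∀ n, Antitone (F n))
    (hone : ∀ n x, F n x ≤ 1) (hnonneg : ∀ n x, 0 ≤ F n x)
    (hF : ∀ x, 0 < x → Tendsto (fun n => F n x) atTop (𝓝 0)) :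
    ∃ ε : ℕ → ℝ, Tendsto ε atTop (𝓝 0) ∧ Tendsto (fun n => F n (ε n)) atTop (𝓝 0) := by
  set T : ℕ → Set ℝ := fun n => {x | 0 ≤ x ∧ F n x ≤ x} with hT
  have hbdd : ∀ n, BddBelow (T n) := fun n => ⟨0, fun x hx => hx.1⟩
  have hne : ∀ n, (T n).Nonempty := fun n => ⟨1, zero_le_one, hone n 1⟩
  have h0 : ∀ n, 0 ≤ sInf (T n) := fun n => le_csInf (hne n) fun x hx => hx.1
  have hinf : Tendsto (fun n => sInf (T n)) atTop (𝓝 0) := by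
    refine tendsto_order.2 ⟨fun a ha => Eventually.of_forall fun n => ha.trans_le (h0 n), ?_⟩
    intro a ha
    filter_upwards [(hF (a / 2) (by positivity)).eventually_le_const
      (show (0 : ℝ) < a / 2 by positivity)] with n hn
    exact (csInf_le (hbdd n) ⟨by positivity, hn⟩).trans_lt (by linarith)
  -- The infimum need not be attained; the vanishing shift leaves a point of `T n` below it.
  have hε : Tendsto (fun n : ℕ => sInf (T n) + 1 / ((n : ℝ) + 1)) atTop (𝓝 0) := by
    simpa using hinf.add tendsto_one_div_add_atTop_nhds_zero_nat
  refine ⟨_, hε, squeeze_zero (fun n => hnonneg n _) (fun n => ?_) hε⟩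
  have hlt : sInf (T n) < sInf (T n) + 1 / ((n : ℝ) + 1) := by
    have : (0 : ℝ) < 1 / ((n : ℝ) + 1) := by positivity
    linarith
  obtain ⟨x, hx, hxlt⟩ := exists_lt_of_csInf_lt (hne n) hlt
  exact (hanti n hxlt.le).trans (hx.2.trans hxlt.le)

lemma tendsto_log_natCast_atTop : Tendsto (fun n : ℕ => Real.log n) atTop atTop :=
  Real.tendsto_log_atTop.comp tendsto_natCast_atTop_atTop

lemma tendsto_log_log_natCast_atTop : Tendsto (fun n : ℕ => Real.log (Real.log n)) atTop atTop :=
  Real.tendsto_log_atTop.comp tendsto_log_natCast_atTop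

lemma tendsto_log_log_pow_div_log (p : ℕ) :
    Tendsto (fun n : ℕ => Real.log (Real.log n) ^ p / Real.log n) atTop (𝓝 0) :=
  (Real.isLittleO_pow_log_id_atTop (n := p)).tendsto_div_nhds_zero.comp tendsto_log_natCast_atTop

namespace RayleighNetwork

section Thresholds

variable {β δ : ℕ → ℝ}

lemma exists_threshold_eq
    (hδ : δ ~[atTop] (fun n : ℕ => 2 * β n * Real.log (Real.log n) / Real.log n)) :
    ∃ u : ℕ → ℝ, Tendsto u atTop (𝓝 1) ∧ ∀ᶠ n : ℕ in atTop,
      δ n = u n * (2 * β n * Real.log (Real.log n) / Real.log n) := by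
  obtain ⟨u, hu, h⟩ := hδ.exists_eq_mul
  exact ⟨u, hu, h⟩

/-- In `log δ = log u + log 2 + log β + log l - l` every term but the last is `o(l)`; for `log β`
this is the hypothesis on `β`. -/
lemma tendsto_log_threshold_div (hβ_pos : ∀ n, 0 < β n)
    (hβ_log : (fun n => Real.log (β n)) =o[atTop] (fun n : ℕ => Real.log (Real.log n)))
    (hδ : δ ~[atTop] (fun n : ℕ => 2 * β n * Real.log (Real.log n) / Real.log n)) :
    Tendsto (fun n => Real.log (δ n) / Real.log (Real.log n)) atTop (𝓝 (-1)) := by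
  obtain ⟨u, hu, hδu⟩ := exists_threshold_eq hδ
  have hlogu : Tendsto (fun n => Real.log (u n)) atTop (𝓝 0) := by
    simpa using hu.log one_ne_zero
  have h1 := hlogu.div_atTop tendsto_log_log_natCast_atTop
  have h2 := (tendsto_const_nhds (x := Real.log 2)).div_atTop tendsto_log_log_natCast_atTop
  have h3 := hβ_log.tendsto_div_nhds_zero
  have h4 : Tendsto (fun n : ℕ => Real.log (Real.log (Real.log n)) / Real.log (Real.log n))
      atTop (𝓝 0) := by
    have := (Real.isLittleO_pow_log_id_atTop (n := 1)).tendsto_div_nhds_zero.comp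
      tendsto_log_log_natCast_atTop
    simpa [Function.comp_def] using this
  have hsum := (((h1.add h2).add h3).add h4).sub (tendsto_const_nhds (x := (1 : ℝ)))
  norm_num at hsum
  refine hsum.congr' ?_
  filter_upwards [hδu, hu.eventually_const_lt (show (0 : ℝ) < 1 by norm_num),
    tendsto_log_natCast_atTop.eventually_gt_atTop 0,
    tendsto_log_log_natCast_atTop.eventually_gt_atTop 0] with n hn hun hL hl
  rw [hn, Real.log_mul hun.ne' (by have := hβ_pos n; positivity), Real.log_div
    (by have := hβ_pos n; positivity) hL.ne', Real.log_mul (by have := hβ_pos n; positivity) hl.ne',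
    Real.log_mul two_ne_zero (hβ_pos n).ne']
  field_simp
  ring

end Thresholds

/-! ### Non-asymptotic bounds for the failure probabilities -/

section Estimates

/-- With more than `(1 + ε) * L / l` links, cliques are unlikely. -/
lemma natCast_mul_one_sub_exp_neg_pow_le {n M : ℕ} {d ε l : ℝ} (hn : 0 < n) (hd : 0 < d)
    (hε : 0 < ε) (hε1 : ε ≤ 1) (hl : 0 < l) (hlog : Real.log d ≤ -(1 - ε / 4) * l)
    (hM : (1 + ε) * (Real.log n / l) ≤ M) :
    n * (1 - Real.exp (-d)) ^ M ≤ Real.exp (-(ε / 4 * Real.log n)) := by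
  have hn' : (0 : ℝ) < n := by exact_mod_cast hn
  have hL : 0 ≤ Real.log n := Real.log_natCast_nonneg n
  have hs0 : 0 ≤ 1 - Real.exp (-d) := by
    rw [sub_nonneg, Real.exp_le_one_iff]
    linarith
  have hs : 1 - Real.exp (-d) ≤ d := by linarith [Real.add_one_le_exp (-d)]
  have hMlog : M * Real.log d ≤ -((1 + ε / 4) * Real.log n) := by
    calc M * Real.log d ≤ M * (-(1 - ε / 4) * l) := by gcongr
      _ = -((1 - ε / 4) * l * M) := by ring
      _ ≤ -((1 - ε / 4) * l * ((1 + ε) * (Real.log n / l))) := by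
          have : 0 ≤ 1 - ε / 4 := by linarith
          gcongr
      _ = -((1 - ε / 4) * (1 + ε) * Real.log n) := by field_simp
      _ ≤ _ := by
          have : 1 + ε / 4 ≤ (1 - ε / 4) * (1 + ε) := by nlinarith
          gcongr
  calc n * (1 - Real.exp (-d)) ^ M ≤ n * d ^ M := by gcongr
    _ = Real.exp (Real.log n + M * Real.log d) := by
        rw [Real.exp_add, Real.exp_log hn', Real.exp_nat_mul, Real.exp_log hd]
    _ ≤ _ := by
        rw [Real.exp_le_exp]
        linarith

/-- With fewer than `(1 - ε) * L / l` links, the second moment ratio is close to one. -/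
lemma mul_inv_div_le {n k : ℕ} {q d ε l : ℝ} (hq : 0 < q) (hd : 0 < d) (hε : 0 < ε)
    (hl : 0 < l) (hlog : -(1 + ε) * l ≤ Real.log d - d)
    (hk0 : 0 < k) (hk : k < (1 - ε) * (Real.log n / l) + 1) (hkL : k ≤ 2 * Real.log n)
    (hkn : k ≤ n) :
    k * (q * (1 - Real.exp (-d)) ^ (k - 1))⁻¹ / (n / k : ℕ)
      ≤ 8 / q * (Real.log n ^ 2 / Real.exp (ε ^ 2 * Real.log n)) := by
  have hn' : (0 : ℝ) < n := by exact_mod_cast hk0.trans_le hkn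
  have hk' : (0 : ℝ) < k := by exact_mod_cast hk0
  have hL : 0 < Real.log n := by linarith
  have hs0 : 0 < 1 - Real.exp (-d) := by
    rw [sub_pos, Real.exp_lt_one_iff]
    linarith
  have hlogs : -((1 + ε) * l) ≤ Real.log (1 - Real.exp (-d)) := by
    have h1 := Real.log_le_log hd (le_one_sub_exp_neg_mul_exp d)
    rw [Real.log_mul hs0.ne' (Real.exp_pos _).ne', Real.log_exp] at h1
    linarith
  -- The exponents multiply to `(1 + ε) * (1 - ε) = 1 - ε ^ 2`, leaving a gain of `n ^ (ε ^ 2)`.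
  have hpow : Real.exp (-((1 - ε ^ 2) * Real.log n)) ≤ (1 - Real.exp (-d)) ^ (k - 1) := by
    rw [← Real.exp_log (pow_pos hs0 (k - 1)), Real.log_pow, Real.exp_le_exp]
    have hk1 : ((k - 1 : ℕ) : ℝ) ≤ (1 - ε) * (Real.log n / l) := by
      rw [Nat.cast_pred hk0]
      linarith
    calc -((1 - ε ^ 2) * Real.log n) = -((1 + ε) * l * ((1 - ε) * (Real.log n / l))) := by
          field_simp; ring
      _ ≤ -((1 + ε) * l * ((k - 1 : ℕ) : ℝ)) := by gcongr
      _ = ((k - 1 : ℕ) : ℝ) * (-((1 + ε) * l)) := by ring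
      _ ≤ _ := by gcongr
  have hm : (n : ℝ) / (2 * k) ≤ (n / k : ℕ) := by
    have h1 : 0 < n / k := Nat.div_pos hkn hk0
    have h2 : n < k * (n / k) + k := by
      have := Nat.div_add_mod n k
      have := Nat.mod_lt n hk0
      omega
    have h3 : (n : ℝ) < k * (n / k : ℕ) + k := by exact_mod_cast h2
    have h4 : (1 : ℝ) ≤ (n / k : ℕ) := by exact_mod_cast h1
    rw [div_le_iff₀ (by positivity)]
    nlinarith
  have hexp : Real.exp (-((1 - ε ^ 2) * Real.log n)) * n = Real.exp (ε ^ 2 * Real.log n) := by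
    nth_rewrite 2 [← Real.exp_log hn']
    rw [← Real.exp_add]
    congr 1; ring
  calc k * (q * (1 - Real.exp (-d)) ^ (k - 1))⁻¹ / (n / k : ℕ)
      ≤ k * (q * Real.exp (-((1 - ε ^ 2) * Real.log n)))⁻¹ / (n / (2 * k)) := by gcongr
    _ = 2 / q * (k ^ 2 / (Real.exp (-((1 - ε ^ 2) * Real.log n)) * n)) := by field_simp
    _ ≤ 2 / q * ((2 * Real.log n) ^ 2 / Real.exp (ε ^ 2 * Real.log n)) := by
        rw [hexp]
        gcongr
    _ = _ := by ring

/-- The Chernoff exponent for about `L / l` links with threshold `2 * u * b * l / L`. -/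
lemma two_mul_exp_chernoff_le {M : ℕ} {L b u d t C B : ℝ} (hL : 0 < L) (hl : 1 ≤ Real.log L)
    (hb : 0 < b) (hbB : b ≤ B) (hu : 0 < u) (hu2 : u ≤ 2) (ht : 0 < t)
    (hd : d = u * (2 * b * Real.log L / L)) (hM : M ≤ 3 * (L / Real.log L))
    (hC : 54 * B ^ 2 / t ^ 2 * (Real.log L ^ 3 / L) ≤ C) :
    M * (2 * Real.exp (M * (d + (3 * Real.log L / t) ^ 2 * d ^ 2 / 8) - 3 * Real.log L / t * t))
      ≤ 6 * Real.exp (12 * B + C) * (L ^ 2)⁻¹ := by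
  set l := Real.log L with hl'
  have hl0 : 0 < l := by linarith
  have hd0 : 0 < d := by rw [hd]; positivity
  have hB : 0 < B := hb.trans_le hbB
  have hd4 : d ≤ 4 * B * l / L := by
    rw [hd]
    calc u * (2 * b * l / L) ≤ 2 * (2 * B * l / L) := by gcongr
      _ = _ := by ring
  have h1 : M * d ≤ 12 * B := by
    calc M * d ≤ 3 * (L / l) * (4 * B * l / L) := by gcongr
      _ = 12 * B := by field_simp; norm_num
  have h2 : M * ((3 * l / t) ^ 2 * d ^ 2 / 8) ≤ C := by
    refine le_trans ?_ hC
    calc M * ((3 * l / t) ^ 2 * d ^ 2 / 8)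
        ≤ 3 * (L / l) * ((3 * l / t) ^ 2 * (4 * B * l / L) ^ 2 / 8) := by gcongr
      _ = _ := by field_simp; ring
  -- The tilt `3 * l / t` yields `L⁻³`; the union over at most `3 * L` links leaves `L⁻²`.
  have h3 : Real.exp (-(3 * l)) = (L ^ 3)⁻¹ := by
    rw [Real.exp_neg, show (3 : ℝ) * l = (3 : ℕ) * l by norm_num, Real.exp_nat_mul, hl',
      Real.exp_log hL]
  have hM3 : (M : ℝ) ≤ 3 * L := hM.trans (by gcongr; exact div_le_self hL.le hl)
  calc M * (2 * Real.exp (M * (d + (3 * l / t) ^ 2 * d ^ 2 / 8) - 3 * l / t * t))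
      ≤ 3 * L * (2 * Real.exp (12 * B + C + -(3 * l))) := by
        have : M * (d + (3 * l / t) ^ 2 * d ^ 2 / 8) - 3 * l / t * t ≤ 12 * B + C + -(3 * l) := by
          rw [mul_add, div_mul_cancel₀ _ ht.ne']
          linarith
        gcongr
    _ = _ := by
        rw [Real.exp_add _ (-(3 * l)), h3]
        field_simp
        norm_num

/-- Here `x = L / l` and the threshold is `u * (2 * b / x)`, so the centre is `b * (c / x) * u` with
both ratios near one. The condition `4 ≤ x * ε` absorbs the `-1` in the lower bound on `c`. -/
lemma abs_mul_half_sub_le {x b u ε c B : ℝ} (hx : 0 < x) (hxε : 4 ≤ x * ε) (hb : 0 < b)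
    (hbB : b ≤ B) (hε1 : ε ≤ 1) (hu : |u - 1| ≤ ε / 4) (hc1 : (1 - ε) * x - 1 ≤ c)
    (hc2 : c ≤ (1 + ε) * x) : |c * (u * (2 * b / x) / 2) - b| ≤ 2 * ε * B := by
  obtain ⟨hu1, hu2⟩ := abs_le.1 hu
  have hε0 : 0 < ε := by
    by_contra h
    nlinarith
  have h1 : 1 - 5 / 4 * ε ≤ c / x := by
    rw [le_div_iff₀ hx]
    nlinarith
  have h2 : c / x ≤ 1 + ε := by rwa [div_le_iff₀ hx]
  have heq : c * (u * (2 * b / x) / 2) - b = b * (c / x * u - 1) := by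
    field_simp
  have h3 : |c / x * u - 1| ≤ 2 * ε := by
    rw [abs_le]
    constructor
    · by_cases h : 0 ≤ 1 - 5 / 4 * ε
      · nlinarith [mul_le_mul h1 (show 1 - ε / 4 ≤ u by linarith) (by linarith) (h.trans h1)]
      · nlinarith [mul_le_mul_of_nonneg_right h1 (show 0 ≤ u by linarith)]
    · nlinarith [mul_le_mul_of_nonneg_right h2 (show 0 ≤ u by linarith)]
  rw [heq, abs_mul, abs_of_pos hb]
  calc b * |c / x * u - 1| ≤ B * (2 * ε) := mul_le_mul hbB h3 (abs_nonneg _) (hb.le.trans hbB)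
    _ = _ := by ring

/-- The rate is a Lipschitz function of the interference. -/
lemma abs_rate_sub_noiseLimitedRate_le {n : ℕ} {ρ b e : ℝ} (hρ : 0 < ρ) (hb : 0 < b)
    {f : Fin n → Fin n → ℝ} {S : Finset (Fin n)} {i : Fin n} (hf : 0 < f i i)
    (he : e ≤ 1 / ρ / 2) (hI : |interference f S i - b| ≤ e) :
    |rate ρ f S i - noiseLimitedRate ρ b f i| ≤ 4 * ρ * e := by
  set a := 1 / ρ with ha
  have ha0 : 0 < a := by positivity
  set I := interference f S i with hI'
  have h1 := abs_le.1 hI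
  have hx : a / 2 ≤ a + I := by linarith
  have hy : a / 2 ≤ a + b := by linarith
  have hx0 : 0 < a + I := by linarith
  have hy0 : 0 < a + b := by linarith
  have e1 : rate ρ f S i = Real.log (a + I + f i i) - Real.log (a + I) := by
    rw [rate, sinr, ← Real.log_div (by positivity) hx0.ne', ← hI', ← ha]
    congr 1; field_simp
  have e2 : noiseLimitedRate ρ b f i = Real.log (a + b + f i i) - Real.log (a + b) := by
    rw [noiseLimitedRate, ← Real.log_div (by positivity) hy0.ne', ← ha]
    congr 1; field_simp
  have d1 := abs_log_sub_log_le (half_pos ha0) hx hy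
  have d2 := abs_log_sub_log_le (half_pos ha0) (show a / 2 ≤ a + I + f i i by linarith)
    (show a / 2 ≤ a + b + f i i by linarith)
  rw [show a + I + f i i - (a + b + f i i) = I - b by ring] at d2
  rw [show a + I - (a + b) = I - b by ring] at d1
  have hle : |I - b| / (a / 2) ≤ 2 * ρ * e := by
    rw [ha, div_le_iff₀ (by positivity)]
    calc |I - b| ≤ e := hI
      _ = _ := by field_simp
  rw [e1, e2]
  calc _ = |(Real.log (a + I + f i i) - Real.log (a + b + f i i))
        - (Real.log (a + I) - Real.log (a + b))| := by congr 1; ring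
    _ ≤ _ := (abs_sub _ _).trans (by linarith)

end Estimates

end RayleighNetwork

/-! ### Assembly of the limit -/

namespace RayleighNetwork

/-- The three failure modes of the concentration of the interference: too few active links, too
many active links, and deviation of a sum of cross coefficients from its mean. -/
lemma IsDTBLAS.measure_exists_lt_abs_le {n : ℕ} {Ω : Type*} [MeasurableSpace Ω] {μ : Measure Ω}
    [IsProbabilityMeasure μ] {g : Ω → Fin n → Fin n → ℝ} {A : Ω → Finset (Fin n)} {Δ δ : ℝ}
    (hg : IsRayleighFading μ g) (hA : IsDTBLAS μ g Δ δ A) (hΔ : 0 ≤ Δ) (hδ : 0 < δ)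
    {k M : ℕ} (hk : 0 < k) (hkn : k ≤ n) {b s t l : ℝ} (hl : 0 ≤ l)
    (hwin : ∀ c : ℝ, (k : ℝ) - 1 ≤ c → c ≤ M - 1 → |c * (δ / 2) - b| ≤ s) :
    μ {ω | ∃ i ∈ A ω, s + t < |interference (g ω) (A ω) i - b|}
      ≤ ENNReal.ofReal (Real.exp (k * (Real.exp (-Δ) * (1 - Real.exp (-δ)) ^ (k - 1))⁻¹
            / (n / k : ℕ)) - 1)
        + ENNReal.ofReal ((n * (1 - Real.exp (-δ)) ^ M) ^ (M + 1))
        + ENNReal.ofReal (M * (2 * Real.exp (M * (δ + l ^ 2 * δ ^ 2 / 8) - l * t))) := by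
  have h1 := hg.measureReal_card_lt_le hA.outcome hΔ hδ (Nat.div_pos hkn hk) (Nat.mul_div_le n k)
  have h2 := hg.measure_le_card_le (fun ω => (hA.outcome ω).1) hδ.le M
  have h3 := hA.measure_card_le_and_exists_lt_abs_le hg hδ.le hl t M
  rw [ENNReal.ofReal_mul (Nat.cast_nonneg M), ENNReal.ofReal_natCast]
  refine le_trans (measure_mono ?_) ((measure_union_le _ _).trans (add_le_add
    ((measure_union_le _ _).trans (add_le_add
      ((ENNReal.le_ofReal_iff_toReal_le (measure_ne_top μ _) ?_).2 h1) h2)) h3))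
  · rintro ω ⟨i, hi, hlt⟩
    by_cases hlow : (A ω).card < k
    · exact Or.inl (Or.inl hlow)
    by_cases hhigh : M + 1 ≤ (A ω).card
    · exact Or.inl (Or.inr hhigh)
    refine Or.inr ⟨by omega, i, hi, ?_⟩
    have hcard : (((A ω).erase i).card : ℝ) = (A ω).card - 1 := by
      rw [Finset.card_erase_of_mem hi, Nat.cast_pred (Finset.card_pos.2 ⟨i, hi⟩)]
    have hc1 : (k : ℝ) ≤ (A ω).card := by exact_mod_cast not_lt.1 hlow
    have hc2 : ((A ω).card : ℝ) ≤ M := by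
      have : (A ω).card ≤ M := by omega
      exact_mod_cast this
    -- A link has `|A| - 1` interferers, hence the window from `k - 1` to `M - 1`.
    have hw := hwin ((A ω).erase i).card (by linarith) (by linarith)
    have htri := abs_sub_le (interference (g ω) (A ω) i) (((A ω).erase i).card * (δ / 2)) b
    linarith
  · exact (measureReal_nonneg).trans h1

set_option maxHeartbeats 1000000 in
theorem tendsto_measure_exists_lt_abs_interference_sub
    {Ω : ℕ → Type*} [∀ n, MeasurableSpace (Ω n)]
    {μ : ∀ n, Measure (Ω n)} [∀ n, IsProbabilityMeasure (μ n)]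
    {g : ∀ n, Ω n → Fin n → Fin n → ℝ} (hg : ∀ n, IsRayleighFading (μ n) (g n))
    {ρ γ₀ : ℝ} (hρ : 0 < ρ) (hγ₀ : 0 < γ₀) {β : ℕ → ℝ} (hβ_pos : ∀ n, 0 < β n)
    (hβ_bdd : β =O[atTop] (fun _ => (1 : ℝ)))
    (hβ_log : (fun n => Real.log (β n)) =o[atTop] (fun n : ℕ => Real.log (Real.log n)))
    {δ : ℕ → ℝ}
    (hδ : δ ~[atTop] (fun n : ℕ => 2 * β n * Real.log (Real.log n) / Real.log n))
    {A : ∀ n, Ω n → Finset (Fin n)}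
    (hA : ∀ n, IsDTBLAS (μ n) (g n) (γ₀ * (1 / ρ + β n)) (δ n) (A n)) {t : ℝ} (ht : 0 < t) :
    Tendsto (fun n => μ n {ω | ∃ i ∈ A n ω, t < |interference (g n ω) (A n ω) i - β n|})
      atTop (𝓝 0) := by
  obtain ⟨B, hB0, hB⟩ : ∃ B : ℝ, 0 < B ∧ ∀ᶠ n in atTop, β n ≤ B := by
    obtain ⟨c, hc, hcb⟩ := hβ_bdd.exists_pos
    refine ⟨c, hc, hcb.bound.mono fun n hn => ?_⟩
    rw [norm_one, mul_one] at hn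
    exact (le_abs_self _).trans hn
  -- Half of the tolerance `t` goes to the error of the centre, at most `2 * ε * B`, and half to the
  -- Chernoff deviation.
  set ε : ℝ := min (1 / 2) (t / (4 * B)) with hε
  have hε0 : 0 < ε := by rw [hε]; positivity
  have hε1 : ε ≤ 1 / 2 := min_le_left _ _
  have hεB : 2 * ε * B ≤ t / 2 := by
    have : ε ≤ t / (4 * B) := min_le_right _ _
    rw [le_div_iff₀ (by positivity)] at this
    linarith
  obtain ⟨u, hu, hδu⟩ := exists_threshold_eq hδ
  have hratio := tendsto_log_threshold_div hβ_pos hβ_log hδ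
  -- Bounds the direct threshold eventually, so the probability of surviving phase one stays away
  -- from zero.
  set D := γ₀ * (1 / ρ + B) with hD
  have hlim1 : Tendsto (fun n : ℕ => ENNReal.ofReal (Real.exp (8 * Real.exp D *
      (Real.log n ^ 2 / Real.exp (ε ^ 2 * Real.log n))) - 1)) atTop (𝓝 0) := by
    have h := ((isLittleO_pow_exp_pos_mul_atTop 2
      (show 0 < ε ^ 2 by positivity)).tendsto_div_nhds_zero.comp tendsto_log_natCast_atTop).const_mul
        (8 * Real.exp D)
    rw [mul_zero] at h
    have h' := ENNReal.tendsto_ofReal ((Real.continuous_exp.tendsto 0).comp h |>.sub_const 1)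
    simpa [Function.comp_def] using h'
  have hlim2 : Tendsto (fun n : ℕ => ENNReal.ofReal (Real.exp (-(ε / 4 * Real.log n))))
      atTop (𝓝 0) := by
    have h := ENNReal.tendsto_ofReal (Real.tendsto_exp_neg_atTop_nhds_zero.comp
      (tendsto_log_natCast_atTop.const_mul_atTop (show 0 < ε / 4 by positivity)))
    simpa [Function.comp_def] using h
  have hlim3 : Tendsto (fun n : ℕ => ENNReal.ofReal (6 * Real.exp (12 * B + 1) *
      (Real.log n ^ 2)⁻¹)) atTop (𝓝 0) := by
    have h := ENNReal.tendsto_ofReal ((((tendsto_pow_atTop two_ne_zero).comp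
      tendsto_log_natCast_atTop).inv_tendsto_atTop).const_mul (6 * Real.exp (12 * B + 1)))
    simpa [Function.comp_def] using h
  have hlim := (hlim1.add hlim2).add hlim3
  simp only [add_zero] at hlim
  refine tendsto_of_tendsto_of_tendsto_of_le_of_le' tendsto_const_nhds hlim
    (Eventually.of_forall fun n => zero_le) ?_
  have hℓL := tendsto_log_log_pow_div_log 1
  simp only [pow_one] at hℓL
  filter_upwards [hB, hδu, eventually_gt_atTop 0,
    hu.eventually (Metric.closedBall_mem_nhds 1 (show 0 < ε / 4 by positivity)),
    hratio.eventually_lt_const (show -1 < -(1 - ε / 4) by linarith),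
    hratio.eventually_const_lt (show -(1 + ε / 2) < -1 by linarith),
    tendsto_log_natCast_atTop.eventually_ge_atTop 1,
    tendsto_log_log_natCast_atTop.eventually_ge_atTop (max 1 (2 / ε)),
    hℓL.eventually_lt_const (show (0 : ℝ) < min (ε / 4) (1 / (4 * B)) by positivity),
    ((tendsto_log_log_pow_div_log 3).const_mul (54 * B ^ 2 / (t / 2) ^ 2)).eventually_le_const
      (show 54 * B ^ 2 / (t / 2) ^ 2 * 0 < 1 by simp)]
    with n hBn hδn hn hun hr1 hr2 hL1 hl hx hC
  have hl1 : 1 ≤ Real.log (Real.log n) := (le_max_left _ _).trans hl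
  have hlε : 2 / ε ≤ Real.log (Real.log n) := (le_max_right _ _).trans hl
  have hxε : Real.log (Real.log n) / Real.log n ≤ ε / 4 := hx.le.trans (min_le_left _ _)
  have hxB : Real.log (Real.log n) / Real.log n ≤ 1 / (4 * B) := hx.le.trans (min_le_right _ _)
  have hβn := hβ_pos n
  have hCher : ∀ M : ℕ, (M : ℝ) ≤ 3 * (Real.log n / Real.log (Real.log n)) → 0 < u n → u n ≤ 2 →
      _ := fun M hM h0 h2 => two_mul_exp_chernoff_le (M := M) (t := t / 2) (by linarith) hl1 hβn
        hBn h0 h2 (by positivity) hδn hM hC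
  set L := Real.log n with hLdef
  set l := Real.log L with hldef
  set x := L / l with hxdef
  have hL0 : 0 < L := by linarith
  have hl0 : 0 < l := by linarith
  have hx0 : 0 < x := by positivity
  have hlx : l / L = x⁻¹ := by rw [hxdef, inv_div]
  have hx4 : 4 ≤ x * ε := by
    rw [hlx, inv_le_comm₀ hx0 (by positivity), inv_div, div_le_iff₀ hε0] at hxε
    exact hxε
  have hx1 : 8 ≤ x := by nlinarith
  have hxL : x ≤ L := div_le_self hL0.le hl1
  have hun' : |u n - 1| ≤ ε / 4 := hun
  obtain ⟨hu1, hu2⟩ := abs_le.1 hun'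
  have hu0 : 0 < u n := by linarith
  have hδ0 : 0 < δ n := by rw [hδn]; positivity
  have hδ1 : δ n ≤ 1 := by
    rw [hδn]
    calc u n * (2 * β n * l / L) = u n * (2 * β n * (l / L)) := by ring
      _ ≤ 2 * (2 * B * (1 / (4 * B))) := by gcongr; linarith
      _ = 1 := by field_simp; norm_num
  set k := ⌈(1 - ε) * x⌉₊ with hkdef
  set M := ⌈(1 + ε) * x⌉₊ with hMdef
  have hkx : 0 < (1 - ε) * x := mul_pos (by linarith) hx0
  have hk0 : 0 < k := Nat.ceil_pos.2 hkx
  have hk1 : (1 - ε) * x ≤ k := Nat.le_ceil _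
  have hk2 : (k : ℝ) < (1 - ε) * x + 1 := Nat.ceil_lt_add_one hkx.le
  have hM1 : (1 + ε) * x ≤ M := Nat.le_ceil _
  have hM2 : (M : ℝ) < (1 + ε) * x + 1 := Nat.ceil_lt_add_one (by positivity)
  have hkL : (k : ℝ) ≤ 2 * L := by nlinarith
  have hkn : k ≤ n := by
    have h1 := Real.quadratic_le_exp_of_nonneg hL0.le
    rw [hLdef, Real.exp_log (by exact_mod_cast hn), ← hLdef] at h1
    have : (k : ℝ) ≤ n := by nlinarith [sq_nonneg (L - 1)]
    exact_mod_cast this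
  have hlogδ1 : Real.log (δ n) ≤ -(1 - ε / 4) * l := by
    rw [div_lt_iff₀ hl0] at hr1
    exact hr1.le
  -- The extra `δ n ≤ 1` is absorbed by `ε / 2 * l`, since `l ≥ 2 / ε`.
  have hlogδ2 : -(1 + ε) * l ≤ Real.log (δ n) - δ n := by
    rw [lt_div_iff₀ hl0] at hr2
    rw [div_le_iff₀ hε0] at hlε
    linarith
  have hmain := (hA n).measure_exists_lt_abs_le (hg n) (M := M) (b := β n) (s := t / 2)
    (t := t / 2) (l := 3 * l / (t / 2)) (by positivity) hδ0 hk0 hkn (by positivity)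
    (fun c hc1 hc2 => ?_)
  · rw [add_halves] at hmain
    refine hmain.trans (add_le_add (add_le_add ?_ ?_) ?_) <;> refine ENNReal.ofReal_le_ofReal ?_
    · refine sub_le_sub_right (Real.exp_le_exp.2 ((mul_inv_div_le (Real.exp_pos _) hδ0 hε0 hl0
        hlogδ2 hk0 hk2 hkL hkn).trans ?_)) 1
      rw [Real.exp_neg, div_inv_eq_mul]
      have : γ₀ * (1 / ρ + β n) ≤ D := by rw [hD]; gcongr
      gcongr
    · have h := natCast_mul_one_sub_exp_neg_pow_le hn hδ0 hε0 (by linarith) hl0 hlogδ1 hM1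
      have hs : 0 ≤ 1 - Real.exp (-δ n) := by
        rw [sub_nonneg, Real.exp_le_one_iff]
        linarith
      have h1 : n * (1 - Real.exp (-δ n)) ^ M ≤ 1 :=
        h.trans (Real.exp_le_one_iff.2 (by rw [neg_nonpos]; positivity))
      exact (pow_le_of_le_one (by positivity) h1 (Nat.succ_ne_zero M)).trans h
    · exact hCher M (by nlinarith) hu0 (by linarith)
  · have h := abs_mul_half_sub_le (c := c) hx0 hx4 hβn hBn (by linarith) hun'
      (by linarith) (by linarith)
    have heq : δ n = u n * (2 * β n / x) := by rw [hδn, hxdef, div_div_eq_mul_div]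
    rw [heq]
    exact h.trans hεB

end RayleighNetwork

theorem theorem5
    {Ω : ℕ → Type*} [∀ n, MeasurableSpace (Ω n)]
    (μ : ∀ n, Measure (Ω n)) [∀ n, IsProbabilityMeasure (μ n)]
    (g : ∀ n, Ω n → Fin n → Fin n → ℝ)
    (hg : ∀ n, RayleighNetwork.IsRayleighFading (μ n) (g n))
    (ρ γ₀ : ℝ) (hρ : 0 < ρ) (hγ₀ : 0 < γ₀)
    (β : ℕ → ℝ) (hβ_pos : ∀ n, 0 < β n)
    (hβ_bdd : β =O[atTop] (fun _ => (1 : ℝ)))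
    (hβ_log : (fun n => Real.log (β n)) =o[atTop] (fun n : ℕ => Real.log (Real.log n)))
    (δ : ℕ → ℝ)
    (hδ : δ ~[atTop] (fun n : ℕ => 2 * β n * Real.log (Real.log n) / Real.log n))
    (A : ∀ n, Ω n → Finset (Fin n))
    (hA : ∀ n, RayleighNetwork.IsDTBLAS (μ n) (g n) (γ₀ * (1 / ρ + β n)) (δ n) (A n)) :
    ∃ ε : ℕ → ℝ, Tendsto ε atTop (𝓝 0) ∧
      Tendsto (fun n => μ n {ω | ∀ i ∈ A n ω,
          |RayleighNetwork.interference (g n ω) (A n ω) i - β n| ≤ ε n ∧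
          |RayleighNetwork.rate ρ (g n ω) (A n ω) i -
            RayleighNetwork.noiseLimitedRate ρ (β n) (g n ω) i| ≤ ε n})
        atTop (𝓝 1) := by
  set G : ∀ n, ℝ → Set (Ω n) := fun n x => {ω | ∀ i ∈ A n ω,
    |RayleighNetwork.interference (g n ω) (A n ω) i - β n| ≤ x ∧
    |RayleighNetwork.rate ρ (g n ω) (A n ω) i -
      RayleighNetwork.noiseLimitedRate ρ (β n) (g n ω) i| ≤ x} with hG
  have hGmono : ∀ n, Monotone (G n) := fun n x y hxy ω hω i hi =>
    ⟨(hω i hi).1.trans hxy, (hω i hi).2.trans hxy⟩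
  have hlim : ∀ x, 0 < x → Tendsto (fun n => (μ n).real (G n x)ᶜ) atTop (𝓝 0) := by
    intro x hx
    -- The caps serve, in order, the interference bound, positivity of the denominators in the rate
    -- estimate, and its Lipschitz constant `4 * ρ`.
    set y := min x (min (1 / ρ / 2) (x / (4 * ρ))) with hy
    have hy0 : 0 < y := by rw [hy]; positivity
    have hbad := (ENNReal.tendsto_toReal ENNReal.zero_ne_top).comp
      (RayleighNetwork.tendsto_measure_exists_lt_abs_interference_sub hg hρ hγ₀ hβ_pos hβ_bdd
        hβ_log hδ hA hy0)
    refine squeeze_zero (fun n => measureReal_nonneg) (fun n => ?_) hbad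
    refine measureReal_mono (μ := μ n) ?_
    intro ω hω
    by_contra hcon
    refine hω fun i hi => ?_
    have hI : |RayleighNetwork.interference (g n ω) (A n ω) i - β n| ≤ y :=
      not_lt.1 fun h => hcon ⟨i, hi, h⟩
    have hdirect : 0 < g n ω i i := by
      have h1 := RayleighNetwork.mem_phaseOne.1 (((hA n).outcome ω).1.1 hi)
      have := hβ_pos n
      exact lt_trans (by positivity) h1
    refine ⟨hI.trans (min_le_left _ _), ?_⟩
    refine (RayleighNetwork.abs_rate_sub_noiseLimitedRate_le hρ (hβ_pos n) hdirect
      ((min_le_right _ _).trans (min_le_left _ _)) hI).trans ?_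
    have : y ≤ x / (4 * ρ) := (min_le_right _ _).trans (min_le_right _ _)
    rw [le_div_iff₀ (by positivity)] at this
    linarith
  obtain ⟨ε, hε, hFε⟩ := exists_tendsto_zero_of_antitone
    (F := fun n x => (μ n).real (G n x)ᶜ)
    (fun n x y hxy => measureReal_mono (Set.compl_subset_compl.2 (hGmono n hxy)))
    (fun n x => measureReal_le_one) (fun n x => measureReal_nonneg) hlim
  refine ⟨ε, hε, ?_⟩
  have hFε' : Tendsto (fun n => μ n (G n (ε n))ᶜ) atTop (𝓝 0) := by
    rw [← ENNReal.ofReal_zero]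
    exact (ENNReal.tendsto_ofReal hFε).congr fun n => ofReal_measureReal
  have hone := ENNReal.Tendsto.sub (tendsto_const_nhds (x := (1 : ENNReal))) hFε'
    (Or.inl ENNReal.one_ne_top)
  rw [tsub_zero] at hone
  refine tendsto_of_tendsto_of_tendsto_of_le_of_le hone tendsto_const_nhds (fun n => ?_)
    fun n => prob_le_one
  -- Subadditivity alone suffices here, so measurability of the good event is not needed.
  rw [tsub_le_iff_right, ← measure_univ (μ := μ n), ← Set.union_compl_self (G n (ε n))]
  exact measure_union_le _ _
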